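/- **Setting.** Let $\rho$ be a measure on $\mathbb R$ not concentrated at one point and $\Theta$ an open interval on which $b(\theta)=\log\int e^{x\theta}\,d\rho(x)$ is finite; let $\nu_\theta$ be the law with $\frac{d\nu_\theta}{d\rho}(x)=e^{x\theta-b(\theta)}$, let $I=\{\mathbb E[\nu_\theta]:\theta\in\Theta\}$, and for $m,m'\in I$ let $d(m,m')$ be the Kullback–Leibler divergence between the members of the family with means $m$ and $m'$. A bandit instance is $\mu\in I^n$ with a unique best arm $k$, i.e. $\mu_i<\mu_k$ for $i\ne k$; successive rewards of arm $i$ are i.i.d. from the member with mean $\mu_i$, independently across arms. For an instance $b\in I^n$ with unique best arm $k$, put $\mathrm{Alt}(b)=\{\lambda\in I^n:\lambda_k<\lambda_j\text{ for some }j\}$, let $$T^*(b)^{-1}=\sup_{w}\inf_{\lambda\in\mathrm{Alt}(b)}\sum_{i=1}^n w_i\,d(b_i,\lambda_i)$$ (supremum over the probability simplex in $\mathbb R^n$), and let $w^*(b)$ be a maximizing $w$. **Algorithm (Tri-BBAI)** with inputs $\epsilon,\delta,L_1,L_2,L_3,\alpha,\beta$. Let $N_i$ be the current number of pulls of arm $i$,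 $\hat\mu_i$ its empirical mean, and $i^*$ an arm with the largest empirical mean. - *Stage I.* Pull each arm $\lceil L_1\rceil$ times. Put $w^{0}=(1/n,\dots,1/n)$. - *Stage II.* For $q=1,2,\dots,\lfloor\log(1/\delta)\rfloor$: set $b_{i^*}=\hat\mu_{i^*}-\epsilon$, $b_i=\hat\mu_i+\epsilon$ for $i\neq i^*$, and $w^{q}=w^*(b)$, computed with $i^*$ as the best arm; pull each arm $i$ until $N_i\ge\min\{\alpha w^*_i(b)T^*(b)\log(1/\delta),L_2\}$ (no pull if this already holds); leave the stage if $|w^{q}_i-w^{q-1}_i|\le 1/\sqrt n$ for all $i$. - *Stage III.* Let $\tau=\sum_iN_i$ and, for $j\ne i^*$, $Z_j=N_{i^*}d(\hat\mu_{i^*},m_j)+N_jd(\hat\mu_j,m_j)$ with $m_j=\frac{N_{i^*}\hat\mu_{i^*}+N_j\hat\mu_j}{N_{i^*}+N_j}$. If $\min_{j\ne i^*}Z_j\ge\beta(\tau,\delta/2)$, stop and return $i^*$. - *Stage IV.* Otherwise pull each arm until it has been pulled at least $L_3$ times in total, and return the arm with the largest empirical mean. Ties may be broken in any way, $d$ in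 Stage III may be continued in any way to arguments outside $I$, and $T^*(b)$, $w^*(b)$ may be given any value when $b$ is not in $I^n$ or does not have $i^*$ as its unique best arm. Let $N_\delta$ be the total number of pulls. **Theorem 1 (Asymptotic Sample Complexity).** Let $\epsilon=\frac1{\log\log(1/\delta)}$, $L_1=\sqrt{\log(1/\delta)}$, $L_2=\frac{\log(1/\delta)\log\log(1/\delta)}{n}$, $L_3=(\log(1/\delta))^2$ and $\beta(t,\delta)=\log\big(\log(1/\delta)\,t^{\alpha}/\delta\big)$. For every bandit instance $\mu$: 1. for every fixed $\alpha\in(1,e/2]$, Tri-BBAI satisfies $\displaystyle\limsup_{\delta\to0}\frac{\mathbb E_\mu[N_\delta]}{\log(1/\delta)}\le\alpha\,T^*(\mu)$; 2. if $\alpha=\alpha(\delta)\in(1,e/2]$ for all sufficiently small $\delta$ and $\alpha(\delta)\to1$ as $\delta\to0$ (e.g. $\alpha=1+1/\log(1/\delta)$), then $\displaystyle\limsup_{\delta\to0}\frac{\mathbb E_\mu[N_\delta]}{\log(1/\delta)}\le T^*(\mu)$, i.e. the sample complexity is asymptotically optimal. -/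

import Mathlib

open MeasureTheory ProbabilityTheory Filter Topology
open scoped ENNReal

noncomputable section

namespace TriBBAI

/-! ### One-parameter exponential families, parameterised by the mean -/

/-- A one-parameter exponential family on `ℝ`: a reference measure `ρ` and an open interval `Θ`
of natural parameters at which `∫ exp (θ x) dρ` is finite. As `ρ` does not live on a single
point, distinct parameters give distinct means. -/
structure ExpFamily where
  ρ : Measure ℝ
  Θ : Set ℝ
  isOpen_param : IsOpen Θ
  ordConnected_param : Θ.OrdConnected
  integrable_exp : ∀ θ ∈ Θ, Integrable (fun x => Real.exp (θ * x)) ρ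
  nondegenerate : ∀ c : ℝ, ¬ ∀ᵐ x ∂ρ, x = c

namespace ExpFamily

variable (F : ExpFamily)

/-- `ν_θ`, with density `exp (θ x) / ∫ exp (θ y) dρ(y) = exp (θ x - b(θ))` with respect to `ρ`. -/
def ν (θ : ℝ) : Measure ℝ := F.ρ.tilted (fun x => θ * x)

/-- The mean of `ν_θ`. -/
def mean (θ : ℝ) : ℝ := ∫ x, x ∂(F.ν θ)

/-- The mean values of the members of the family. -/
def means : Set ℝ := F.mean '' F.Θ

/-- The member of the family with mean value `m` (meaningful for `m ∈ F.means`). -/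
def law (m : ℝ) : Measure ℝ := F.ν (Function.invFunOn F.mean F.Θ m)

/-- `d(m, m')`: the Kullback-Leibler divergence between the members with means `m` and `m'`
(meaningful for `m, m' ∈ F.means`). -/
def d (m m' : ℝ) : ℝ≥0∞ := InformationTheory.klDiv (F.law m) (F.law m')

variable {n : ℕ}

/-- `b` is a bandit instance of the family whose unique best arm is `k`. -/
def IsInstance (k : Fin n) (b : Fin n → ℝ) : Prop :=
  (∀ i, b i ∈ F.means) ∧ ∀ i, i ≠ k → b i < b k

/-- The alternatives: the models of the family in which arm `k` is not the best arm. -/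
def alt (k : Fin n) : Set (Fin n → ℝ) :=
  {l | (∀ i, l i ∈ F.means) ∧ ∃ j, l k < l j}

/-- `inf_{λ ∈ Alt} ∑ i, w_i d(b_i, λ_i)`. -/
def value (k : Fin n) (b w : Fin n → ℝ) : ℝ≥0∞ :=
  ⨅ l ∈ F.alt k, ∑ i, ENNReal.ofReal (w i) * F.d (b i) (l i)

/-- The characteristic time `T^*(b)` of the instance `b` with best arm `k`. -/
def charTime (k : Fin n) (b : Fin n → ℝ) : ℝ≥0∞ :=
  (⨆ w ∈ stdSimplex ℝ (Fin n), F.value k b w)⁻¹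

/-- `w` is an optimal allocation `w^*(b)` for the instance `b` with best arm `k`. -/
def IsOptimalWeight (k : Fin n) (b w : Fin n → ℝ) : Prop :=
  w ∈ stdSimplex ℝ (Fin n) ∧ ∀ v ∈ stdSimplex ℝ (Fin n), F.value k b v ≤ F.value k b w

end ExpFamily

/-! ### The algorithm -/

/-- The functions evaluated by the algorithm. They are prescribed wherever they are determined
by the family; the remaining freedom is how ties between empirical means are broken, how `d` is
continued to arguments that are not means of the family (an empirical mean can be one), and
which `w^*` and `T^*` are used when the shifted empirical means `b` do not form an instance of
the family with best arm `k`. -/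
structure Rules (F : ExpFamily) (n : ℕ) where
  /-- a position of the maximum, used for `i^*(t)` -/
  leader : (Fin n → ℝ) → Fin n
  leader_max : ∀ (m : Fin n → ℝ) (i : Fin n), m i ≤ m (leader m)
  /-- the divergence in the stopping statistic -/
  div : ℝ → ℝ → ℝ≥0∞
  div_eq : ∀ m ∈ F.means, ∀ m' ∈ F.means, div m m' = F.d m m'
  /-- `T^*(b)`, for `b` with leading arm `k` -/
  time : Fin n → (Fin n → ℝ) → ℝ≥0∞
  time_eq : ∀ k b, F.IsInstance k b → time k b = F.charTime k b
  /-- `w^*(b)`, for `b` with leading arm `k` -/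
  weight : Fin n → (Fin n → ℝ) → Fin n → ℝ
  weight_opt : ∀ k b, F.IsInstance k b → (∃ w, F.IsOptimalWeight k b w) →
    F.IsOptimalWeight k b (weight k b)

/-- The inputs of the algorithm. -/
structure Params where
  δ : ℝ
  ε : ℝ
  L₁ : ℝ
  L₂ : ℝ
  L₃ : ℝ
  α : ℝ
  β : ℝ → ℝ → ℝ

section Algorithm

variable {F : ExpFamily} {n : ℕ} (R : Rules F n) (p : Params)

/-- The empirical means when arm `i` has been pulled `N i` times, where `x i s` is the reward of
the `(s + 1)`-st pull of arm `i`. -/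
def empMean (x : Fin n → ℕ → ℝ) (N : Fin n → ℕ) (i : Fin n) : ℝ :=
  (∑ s ∈ Finset.range (N i), x i s) / (N i : ℝ)

/-- The vector `b`: the leading empirical mean is lowered by `ε`, the others are raised by `ε`. -/
def shifted (x : Fin n → ℕ → ℝ) (N : Fin n → ℕ) (i : Fin n) : ℝ :=
  if i = R.leader (empMean x N) then empMean x N i - p.ε else empMean x N i + p.ε

/-- The allocation `w^*(b)` computed from the data. -/
def nextWeight (x : Fin n → ℕ → ℝ) (N : Fin n → ℕ) : Fin n → ℝ :=
  R.weight (R.leader (empMean x N)) (shifted R p x N)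

/-- `min {α w^*_i(b) T^*(b) log (1/δ), L₂}`. -/
def target (x : Fin n → ℕ → ℝ) (N : Fin n → ℕ) (i : Fin n) : ℝ :=
  (min (ENNReal.ofReal (p.α * nextWeight R p x N i * Real.log (1 / p.δ)) *
      R.time (R.leader (empMean x N)) (shifted R p x N))
    (ENNReal.ofReal p.L₂)).toReal

/-- The pull counts after one more batch of Stage II: arm `i` is pulled until its count reaches
the (rounded up) target, and not at all if it is there already. -/
def nextPulls (x : Fin n → ℕ → ℝ) (N : Fin n → ℕ) (i : Fin n) : ℕ :=
  max (N i) ⌈target R p x N i⌉₊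

open Classical in
/-- Stage II with `r` batches left, pull counts `N` and previous allocation `w`: run one batch and
leave the stage if the new allocation is within `1 / √n` of the previous one in each coordinate.
Returns the pull counts at the end of the stage. -/
def stageTwo (x : Fin n → ℕ → ℝ) : ℕ → (Fin n → ℕ) → (Fin n → ℝ) → (Fin n → ℕ)
  | 0, N, _ => N
  | r + 1, N, w =>
      if ∀ i, |nextWeight R p x N i - w i| ≤ 1 / Real.sqrt n then nextPulls R p x N
      else stageTwo x r (nextPulls R p x N) (nextWeight R p x N)

/-- Pull counts at the end of Stage II: Stage I pulls each arm `⌈L₁⌉` times, then Stage II runs at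
most `⌊log (1/δ)⌋` batches, starting from the uniform allocation. -/
def explore (x : Fin n → ℕ → ℝ) : Fin n → ℕ :=
  stageTwo R p x ⌊Real.log (1 / p.δ)⌋₊ (fun _ => ⌈p.L₁⌉₊) (fun _ => 1 / (n : ℝ))

/-- The statistic `Z_{ij}` of Chernoff's stopping rule. -/
def chernoffZ (x : Fin n → ℕ → ℝ) (N : Fin n → ℕ) (i j : Fin n) : ℝ≥0∞ :=
  let mij : ℝ := (N i * empMean x N i + N j * empMean x N j) / ((N i : ℝ) + (N j : ℝ))
  R.div (empMean x N i) mij * (N i : ℝ≥0∞) + R.div (empMean x N j) mij * (N j : ℝ≥0∞)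

/-- Stage III: `Z_j(τ) ≥ β(τ, δ/2)` for each arm `j` other than the leader, where `τ` is the
number of pulls so far. -/
def stops (x : Fin n → ℕ → ℝ) (N : Fin n → ℕ) : Prop :=
  ∀ j, j ≠ R.leader (empMean x N) →
    ENNReal.ofReal (p.β ((∑ i, N i : ℕ) : ℝ) (p.δ / 2)) ≤
      chernoffZ R x N (R.leader (empMean x N)) j

open Classical in
/-- Final pull counts: if the test fails, Stage IV pulls each arm up to `⌈L₃⌉` times in total. -/
def finalPulls (x : Fin n → ℕ → ℝ) : Fin n → ℕ :=
  if stops R p x (explore R p x) then explore R p x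
  else fun i => max (explore R p x i) ⌈p.L₃⌉₊

/-- The returned arm. -/
def returnedArm (x : Fin n → ℕ → ℝ) : Fin n :=
  R.leader (empMean x (finalPulls R p x))

/-- `N_δ`: the total number of pulls. -/
def numPulls (x : Fin n → ℕ → ℝ) : ℕ := ∑ i, finalPulls R p x i

end Algorithm

/-- `ε = 1 / log log (1/δ)`, `L₁ = √(log (1/δ))`, `L₂ = log (1/δ) log log (1/δ) / n`,
`L₃ = (log (1/δ))²` and `β(t, δ) = log (log (1/δ) t^α / δ)`. -/
def params (n : ℕ) (α δ : ℝ) : Params where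
  δ := δ
  ε := 1 / Real.log (Real.log (1 / δ))
  L₁ := Real.sqrt (Real.log (1 / δ))
  L₂ := Real.log (1 / δ) * Real.log (Real.log (1 / δ)) / n
  L₃ := Real.log (1 / δ) ^ 2
  α := α
  β := fun t η => Real.log (Real.log (1 / η) * t ^ α / η)

/-- `E[N_δ] / log (1/δ)` when the rewards are `X i s ω` and the algorithm uses the above inputs. -/
def normalizedCost {F : ExpFamily} {n : ℕ} (R : Rules F n) {Ω : Type*} [MeasurableSpace Ω]
    (P : Measure Ω) (X : Fin n → ℕ → Ω → ℝ) (α δ : ℝ) : ℝ≥0∞ :=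
  (∫⁻ ω, (numPulls R (params n α δ) (fun i s => X i s ω) : ℝ≥0∞) ∂P) /
    ENNReal.ofReal (Real.log (1 / δ))

end TriBBAI

end

/-! ### Exponential families: means, and the divergence as a Bregman divergence -/

namespace TriBBAI

namespace ExpFamily

variable (F : ExpFamily)

/-! Write `L = log (1/δ)` and `η = ε/4 = 1/(4 log L)`. On the event `Concentrated` that from pull
`⌈√L⌉` on every empirical mean stays within `η` of its true value, the run is controlled
deterministically. The leader is `k`, so each shifted vector `b` lies within `5η` of `μ`. Hence
`w^*(b) T^*(b)` is at most `w^*(μ) T^*(μ) + κ` coordinatewise. Targets are total counts, so after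
Stage II arm `i` has at most about `√L + α L (w^*_i(μ) T^*(μ) + κ)` pulls, and summing over `i`
gives `α L (T^*(μ) + n κ)` up to lower order.

The test then succeeds. The first batch alone forces at least `α L w^*_i(b) T^*(b)` pulls of arm
`i`, for a `b` whose leading arm lies at least `3η` below its true mean and whose other arms lie at
least `3η` above theirs. The final empirical means are therefore at least `2η` further out than `b`
on both sides. By the compensation identity this stretches the divergences by a factor `1 + 2η/Δ`,
so every `Z_j` is at least `(1 + 2η/Δ) α L`. The surplus `2ηL/Δ = L/(2Δ log L)` beats the `7 log L`
by which the threshold exceeds `L`. The surplus comes from the shift `ε`, not from `α > 1`, which is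
why `α → 1` is allowed.

Off this event the cost is still at most `(2n+1) L²`, by the cap `L₂` and the size of Stage IV.
Chernoff bounds give the event probability at most `2n/L²`, because `√L η²` dominates `log L`. Its
contribution is bounded and vanishes after division by `L`. Finally `δ → 0` and then `κ → 0`.

The analytic core is the behaviour of `w^*` and `T^*` near `μ`. The inner infimum is a minimum over
`j ≠ k` of two-arm costs `gap` (`ofReal_le_value_iff`). Optimal weights are unique
(`IsOptimalWeight.unique`), so compactness of the simplex makes them continuous
(`IsOptimalWeight.tendsto`). `T^*` is upper semicontinuous because weights optimal at `μ` remain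
nearly optimal nearby. -/

/-- The natural parameter of the member of the family with mean `m`. -/
noncomputable def param (m : ℝ) : ℝ := Function.invFunOn F.mean F.Θ m

/-- The log-partition function. -/
noncomputable def logPartition (θ : ℝ) : ℝ := cgf id F.ρ θ

/-- The divergence as a Bregman divergence of the log-partition function. -/
noncomputable def bregman (x l : ℝ) : ℝ :=
  F.logPartition (F.param l) - F.logPartition (F.param x) - x * (F.param l - F.param x)

lemma neZero_ρ : NeZero F.ρ :=
  ⟨fun h => F.nondegenerate 0 (by simp [h])⟩

lemma mem_interior_integrableExpSet {θ : ℝ} (hθ : θ ∈ F.Θ) :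
    θ ∈ interior (integrableExpSet id F.ρ) :=
  interior_mono (fun t ht => F.integrable_exp t ht) (F.isOpen_param.interior_eq.symm ▸ hθ)

lemma isProbabilityMeasure_ν {θ : ℝ} (hθ : θ ∈ F.Θ) : IsProbabilityMeasure (F.ν θ) :=
  haveI := F.neZero_ρ
  isProbabilityMeasure_tilted (F.integrable_exp θ hθ)

lemma mean_eq_deriv {θ : ℝ} (hθ : θ ∈ F.Θ) : F.mean θ = deriv F.logPartition θ :=
  integral_tilted_mul_self (X := id) (F.mem_interior_integrableExpSet hθ)

lemma analyticAt_logPartition {θ : ℝ} (hθ : θ ∈ F.Θ) : AnalyticAt ℝ F.logPartition θ :=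
  analyticAt_cgf (F.mem_interior_integrableExpSet hθ)

lemma integral_exp_eq_exp_logPartition {θ : ℝ} (hθ : θ ∈ F.Θ) :
    ∫ x, Real.exp (θ * x) ∂F.ρ = Real.exp (F.logPartition θ) :=
  haveI := F.neZero_ρ
  (exp_cgf (X := id) (F.integrable_exp θ hθ)).symm

/-- Tilts compose, so two members can be compared inside a single probability measure instead of
through `ρ`, which may be infinite. -/
lemma ν_tilted {θ : ℝ} (hθ : θ ∈ F.Θ) (θ' : ℝ) :
    (F.ν θ).tilted (fun x => (θ' - θ) * x) = F.ν θ' := by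
  rw [ν, tilted_tilted (F.integrable_exp θ hθ), ν]
  congr 1
  ext x
  simp only [Pi.add_apply]
  ring

lemma integrable_id_ν {θ : ℝ} (hθ : θ ∈ F.Θ) : Integrable (fun x : ℝ => x) (F.ν θ) :=
  memLp_one_iff_integrable.mp (memLp_tilted_mul (X := id) (F.mem_interior_integrableExpSet hθ) 1)

lemma integrable_exp_ν {θ θ' : ℝ} (hθ : θ ∈ F.Θ) (hθ' : θ' ∈ F.Θ) :
    Integrable (fun x => Real.exp ((θ' - θ) * x)) (F.ν θ) := by
  rw [ν, integrable_tilted_iff (F.integrable_exp θ hθ)]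
  refine (F.integrable_exp θ' hθ').congr (ae_of_all _ fun x => ?_)
  simp only [smul_eq_mul]
  rw [← Real.exp_add]
  ring_nf

lemma integral_exp_ν {θ θ' : ℝ} (hθ : θ ∈ F.Θ) (hθ' : θ' ∈ F.Θ) :
    ∫ x, Real.exp ((θ' - θ) * x) ∂F.ν θ = Real.exp (F.logPartition θ' - F.logPartition θ) := by
  rw [ν, integral_exp_tilted, Real.exp_sub, ← F.integral_exp_eq_exp_logPartition hθ,
    ← F.integral_exp_eq_exp_logPartition hθ']
  congr 1
  refine integral_congr_ae (ae_of_all _ fun x => ?_)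
  simp only [Pi.add_apply]
  ring_nf

lemma ν_absolutelyContinuous (θ : ℝ) {θ' : ℝ} (hθ' : θ' ∈ F.Θ) : F.ν θ ≪ F.ν θ' :=
  (tilted_absolutelyContinuous _ _).trans (absolutelyContinuous_tilted (F.integrable_exp θ' hθ'))

lemma integrable_llr_ν {θ θ' : ℝ} (hθ : θ ∈ F.Θ) (hθ' : θ' ∈ F.Θ) :
    Integrable (llr (F.ν θ) (F.ν θ')) (F.ν θ) := by
  have := F.isProbabilityMeasure_ν hθ
  rw [← F.ν_tilted hθ θ']
  refine integrable_llr_tilted_right Measure.AbsolutelyContinuous.rfl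
    ((F.integrable_id_ν hθ).const_mul _) ?_ (F.integrable_exp_ν hθ hθ')
  exact (integrable_zero _ _ _).congr (llr_self _).symm

lemma integral_llr_ν {θ θ' : ℝ} (hθ : θ ∈ F.Θ) (hθ' : θ' ∈ F.Θ) :
    ∫ x, llr (F.ν θ) (F.ν θ') x ∂F.ν θ =
      F.logPartition θ' - F.logPartition θ - F.mean θ * (θ' - θ) := by
  have := F.isProbabilityMeasure_ν hθ
  have h0 : Integrable (llr (F.ν θ) (F.ν θ)) (F.ν θ) :=
    (integrable_zero _ _ _).congr (llr_self _).symm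
  have h1 : ∫ x, llr (F.ν θ) (F.ν θ) x ∂F.ν θ = 0 := by
    rw [integral_congr_ae (llr_self _)]; simp
  rw [← F.ν_tilted hθ θ', integral_llr_tilted_right Measure.AbsolutelyContinuous.rfl
    ((F.integrable_id_ν hθ).const_mul _) (F.integrable_exp_ν hθ hθ') h0, h1,
    F.integral_exp_ν hθ hθ', Real.log_exp, integral_const_mul, mean]
  ring

lemma klDiv_ν {θ θ' : ℝ} (hθ : θ ∈ F.Θ) (hθ' : θ' ∈ F.Θ) :
    InformationTheory.klDiv (F.ν θ) (F.ν θ') =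
      ENNReal.ofReal (F.logPartition θ' - F.logPartition θ - F.mean θ * (θ' - θ)) := by
  have := F.isProbabilityMeasure_ν hθ
  have := F.isProbabilityMeasure_ν hθ'
  rw [InformationTheory.klDiv_of_ac_of_integrable (F.ν_absolutelyContinuous θ hθ')
    (F.integrable_llr_ν hθ hθ'), F.integral_llr_ν hθ hθ']
  simp

lemma gibbs_nonneg {θ θ' : ℝ} (hθ : θ ∈ F.Θ) (hθ' : θ' ∈ F.Θ) :
    0 ≤ F.logPartition θ' - F.logPartition θ - F.mean θ * (θ' - θ) := by
  have := F.isProbabilityMeasure_ν hθ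
  have := F.isProbabilityMeasure_ν hθ'
  have := InformationTheory.integral_llr_add_sub_measure_univ_nonneg
    (F.ν_absolutelyContinuous θ hθ') (F.integrable_llr_ν hθ hθ')
  rw [F.integral_llr_ν hθ hθ'] at this
  simpa using this

/-- If two members coincide, the density of one with respect to the other, the exponential of a
nonconstant affine function, is almost everywhere `1`. Then `x` is `ρ`-almost everywhere constant,
against nondegeneracy. -/
lemma ν_injOn : Set.InjOn F.ν F.Θ := by
  intro θ hθ θ' hθ' h
  by_contra hne
  have hp := F.isProbabilityMeasure_ν hθ
  have h1 : (fun x => (θ' - θ) * x) - (fun x => F.logPartition θ' - F.logPartition θ)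
      =ᵐ[F.ν θ] 0 := by
    have h2 := log_rnDeriv_tilted_left_self (F.integrable_exp_ν hθ hθ')
    rw [F.ν_tilted hθ θ', ← h, F.integral_exp_ν hθ hθ', Real.log_exp] at h2
    filter_upwards [h2, Measure.rnDeriv_self (F.ν θ)] with x hx hx'
    rw [hx'] at hx
    simp at hx
    simp
    linarith
  refine F.nondegenerate ((F.logPartition θ' - F.logPartition θ) / (θ' - θ)) ?_
  have hac : F.ρ ≪ F.ν θ := absolutelyContinuous_tilted (F.integrable_exp θ hθ)
  filter_upwards [hac.ae_le h1] with x hx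
  simp only [Pi.sub_apply, Pi.zero_apply] at hx
  rw [eq_div_iff (sub_ne_zero.mpr (Ne.symm hne))]
  linarith

lemma gibbs_pos {θ θ' : ℝ} (hθ : θ ∈ F.Θ) (hθ' : θ' ∈ F.Θ) (hne : θ ≠ θ') :
    0 < F.logPartition θ' - F.logPartition θ - F.mean θ * (θ' - θ) := by
  refine lt_of_le_of_ne (F.gibbs_nonneg hθ hθ') fun h => hne ?_
  have := F.isProbabilityMeasure_ν hθ
  have := F.isProbabilityMeasure_ν hθ'
  refine F.ν_injOn hθ hθ' (InformationTheory.klDiv_eq_zero_iff.mp ?_)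
  rw [F.klDiv_ν hθ hθ', ← h, ENNReal.ofReal_zero]

/-- Adding the strict Gibbs inequalities for `(θ, θ')` and `(θ', θ)` cancels the log-partition terms
and leaves `(mean θ' - mean θ) (θ' - θ) > 0`. -/
lemma strictMonoOn_mean : StrictMonoOn F.mean F.Θ := by
  intro θ hθ θ' hθ' h
  have h1 := F.gibbs_pos hθ hθ' h.ne
  have h2 := F.gibbs_pos hθ' hθ h.ne'
  nlinarith

lemma continuousOn_mean : ContinuousOn F.mean F.Θ := by
  have h : ContinuousOn (deriv F.logPartition) F.Θ := fun θ hθ =>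
    (F.analyticAt_logPartition hθ).deriv.continuousAt.continuousWithinAt
  exact h.congr fun θ hθ => F.mean_eq_deriv hθ

lemma ordConnected_means : F.means.OrdConnected :=
  (F.ordConnected_param.isPreconnected.image _ F.continuousOn_mean).ordConnected

lemma isOpen_means : IsOpen F.means := by
  rw [isOpen_iff_mem_nhds]
  rintro _ ⟨θ, hθ, rfl⟩
  obtain ⟨a, b, hab, hsub⟩ := mem_nhds_iff_exists_Ioo_subset.mp (F.isOpen_param.mem_nhds hθ)
  obtain ⟨a', ha'⟩ := exists_between hab.1
  obtain ⟨b', hb'⟩ := exists_between hab.2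
  have ha : a' ∈ F.Θ := hsub ⟨ha'.1, ha'.2.trans hab.2⟩
  have hb : b' ∈ F.Θ := hsub ⟨hab.1.trans hb'.1, hb'.2⟩
  refine mem_of_superset (Ioo_mem_nhds (F.strictMonoOn_mean ha hθ ha'.2)
    (F.strictMonoOn_mean hθ hb hb'.1)) fun x hx => ?_
  exact F.ordConnected_means.out ⟨a', ha, rfl⟩ ⟨b', hb, rfl⟩ ⟨hx.1.le, hx.2.le⟩

lemma param_mem {m : ℝ} (hm : m ∈ F.means) : F.param m ∈ F.Θ :=
  Function.invFunOn_mem hm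

lemma mean_param {m : ℝ} (hm : m ∈ F.means) : F.mean (F.param m) = m :=
  Function.invFunOn_eq hm

lemma strictMonoOn_param : StrictMonoOn F.param F.means := by
  intro m hm m' hm' h
  rw [← F.strictMonoOn_mean.lt_iff_lt (F.param_mem hm) (F.param_mem hm'), F.mean_param hm,
    F.mean_param hm']
  exact h

lemma image_param : F.param '' F.means = F.Θ := by
  ext θ
  constructor
  · rintro ⟨m, hm, rfl⟩
    exact F.param_mem hm
  · intro hθ
    have hm : F.mean θ ∈ F.means := ⟨θ, hθ, rfl⟩
    exact ⟨F.mean θ, hm, F.strictMonoOn_mean.injOn (F.param_mem hm) hθ (F.mean_param hm)⟩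

lemma continuousAt_param {m : ℝ} (hm : m ∈ F.means) : ContinuousAt F.param m :=
  F.strictMonoOn_param.continuousAt_of_image_mem_nhds (F.isOpen_means.mem_nhds hm)
    (F.image_param.symm ▸ F.isOpen_param.mem_nhds (F.param_mem hm))

lemma d_eq_bregman {x l : ℝ} (hx : x ∈ F.means) (hl : l ∈ F.means) :
    F.d x l = ENNReal.ofReal (F.bregman x l) := by
  rw [d, law, law, bregman]
  change InformationTheory.klDiv (F.ν (F.param x)) (F.ν (F.param l)) = _
  rw [F.klDiv_ν (F.param_mem hx) (F.param_mem hl), F.mean_param hx]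

lemma bregman_nonneg {x l : ℝ} (hx : x ∈ F.means) (hl : l ∈ F.means) : 0 ≤ F.bregman x l := by
  have := F.gibbs_nonneg (F.param_mem hx) (F.param_mem hl)
  rwa [F.mean_param hx] at this

lemma bregman_pos {x l : ℝ} (hx : x ∈ F.means) (hl : l ∈ F.means) (h : x ≠ l) :
    0 < F.bregman x l := by
  have := F.gibbs_pos (F.param_mem hx) (F.param_mem hl)
    fun e => h (F.strictMonoOn_param.injOn hx hl e)
  rwa [F.mean_param hx] at this

@[simp]
lemma bregman_self (x : ℝ) : F.bregman x x = 0 := by simp [bregman]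

lemma bregman_eq_zero {x l : ℝ} (hx : x ∈ F.means) (hl : l ∈ F.means) (h : F.bregman x l = 0) :
    x = l := by
  by_contra hne
  exact (F.bregman_pos hx hl hne).ne' h

lemma continuousAt_bregman {x l : ℝ} (hx : x ∈ F.means) (hl : l ∈ F.means) :
    ContinuousAt (fun p : ℝ × ℝ => F.bregman p.1 p.2) (x, l) := by
  have hA : ∀ {m}, m ∈ F.means → ContinuousAt (fun y => F.logPartition (F.param y)) m :=
    fun hm => ContinuousAt.comp (g := F.logPartition)
      (F.analyticAt_logPartition (F.param_mem hm)).continuousAt (F.continuousAt_param hm)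
  have h1 : ContinuousAt (fun p : ℝ × ℝ => F.param p.1) (x, l) :=
    ContinuousAt.comp (g := F.param) (f := Prod.fst) (F.continuousAt_param hx) continuousAt_fst
  have h2 : ContinuousAt (fun p : ℝ × ℝ => F.param p.2) (x, l) :=
    ContinuousAt.comp (g := F.param) (f := Prod.snd) (F.continuousAt_param hl) continuousAt_snd
  have h3 : ContinuousAt (fun p : ℝ × ℝ => F.logPartition (F.param p.1)) (x, l) :=
    ContinuousAt.comp (f := Prod.fst) (hA hx) continuousAt_fst
  have h4 : ContinuousAt (fun p : ℝ × ℝ => F.logPartition (F.param p.2)) (x, l) :=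
    ContinuousAt.comp (f := Prod.snd) (hA hl) continuousAt_snd
  exact (h4.sub h3).sub (continuousAt_fst.mul (h2.sub h1))

/-- The compensation identity for two points. -/
lemma bregman_compensation {u v x y m : ℝ} (l : ℝ) (hm : (u + v) * m = u * x + v * y) :
    u * F.bregman x l + v * F.bregman y l =
      u * F.bregman x m + v * F.bregman y m + (u + v) * F.bregman m l := by
  simp only [bregman]
  linear_combination (F.param l - F.param m) * hm

/-- The three-point identity `d(x,l') - d(x,l) = d(l,l') + (l - x)(param l' - param l)` has two
nonnegative terms on the right. -/
lemma bregman_le_of_le_left {x l l' : ℝ} (hl : l ∈ F.means)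
    (hl' : l' ∈ F.means) (h1 : x ≤ l) (h2 : l ≤ l') : F.bregman x l ≤ F.bregman x l' := by
  have h3 := F.bregman_nonneg hl hl'
  have h4 := F.strictMonoOn_param.monotoneOn hl hl' h2
  simp only [bregman] at *
  nlinarith [mul_nonneg (sub_nonneg.mpr h1) (sub_nonneg.mpr h4)]

lemma bregman_le_of_le_right {x l l' : ℝ} (hl : l ∈ F.means)
    (hl' : l' ∈ F.means) (h1 : l ≤ x) (h2 : l' ≤ l) : F.bregman x l ≤ F.bregman x l' := by
  have h3 := F.bregman_nonneg hl hl'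
  have h4 := F.strictMonoOn_param.monotoneOn hl' hl h2
  simp only [bregman] at *
  nlinarith [mul_nonneg (sub_nonneg.mpr h1) (sub_nonneg.mpr h4)]

/-- Moving the first argument away from the second by a fraction `s` of their distance
increases the divergence at least by that fraction. -/
lemma bregman_stretch {x x' l s : ℝ} (hx : x ∈ F.means) (hl : l ∈ F.means) (hx' : x' ∈ F.means)
    (hs : 0 ≤ s) (hst : s * (x - l) ^ 2 ≤ (x' - x) * (x - l)) :
    (1 + s) * F.bregman x l ≤ F.bregman x' l := by
  by_cases hne : x = l
  · rw [hne, bregman_self, mul_zero]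
    exact F.bregman_nonneg hx' hl
  have hne' : x - l ≠ 0 := sub_ne_zero.mpr hne
  obtain ⟨t, ht⟩ : ∃ t, t = (x' - x) / (x - l) := ⟨_, rfl⟩
  have ht' : x' = x + t * (x - l) := by
    rw [ht, div_mul_cancel₀ _ hne']
    ring
  have hle : s ≤ t := by
    rw [ht'] at hst
    have : 0 < (x - l) ^ 2 := by positivity
    nlinarith
  -- `x` is the mean of `x'` and `l` with weights `1` and `t`, and the cost of `l` to itself is
  -- zero. The identity thus bounds `d(x',l)` below by `(1 + t) d(x,l)`.
  have h := F.bregman_compensation (u := 1) (v := t) (x := x') (y := l) (m := x) l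
    (by rw [ht']; ring)
  have h1 := F.bregman_nonneg hx' hx
  have h2 := F.bregman_nonneg hl hx
  have h3 := F.bregman_nonneg hx hl
  rw [F.bregman_self] at h
  nlinarith [mul_nonneg (hs.trans hle) h2, mul_nonneg (sub_nonneg.mpr hle) h3]

end ExpFamily

end TriBBAI

/-! ### The max-min problem: reduction to pairs of arms, existence and uniqueness of optimal weights
-/

namespace TriBBAI

namespace ExpFamily

variable (F : ExpFamily) {n : ℕ}

/-- The mean of the arms `k` and `j` pooled with weights `w`. -/
noncomputable def pooled (b w : Fin n → ℝ) (k j : Fin n) : ℝ :=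
  (w k * b k + w j * b j) / (w k + w j)

/-- The cost of moving the arms `k` and `j` to the common mean `l`. -/
noncomputable def moveCost (b w : Fin n → ℝ) (k j : Fin n) (l : ℝ) : ℝ :=
  w k * F.bregman (b k) l + w j * F.bregman (b j) l

/-- The least cost of moving the arms `k` and `j` to a common mean. -/
noncomputable def gap (b w : Fin n → ℝ) (k j : Fin n) : ℝ :=
  F.moveCost b w k j (pooled b w k j)

variable {F} {k j : Fin n} {b w : Fin n → ℝ}

lemma IsInstance.le (hb : F.IsInstance k b) (j : Fin n) : b j ≤ b k := by
  by_cases h : j = k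
  · rw [h]
  · exact (hb.2 j h).le

lemma IsInstance.mem_of_mem_Icc (hb : F.IsInstance k b) {m : ℝ}
    (hm : m ∈ Set.Icc (b j) (b k)) : m ∈ F.means :=
  F.ordConnected_means.out (hb.1 j) (hb.1 k) hm

lemma pooled_spec (h : w k + w j ≠ 0) :
    (w k + w j) * pooled b w k j = w k * b k + w j * b j := by
  rw [pooled, mul_div_cancel₀ _ h]

lemma pooled_mem_Icc (hb : b j ≤ b k) (hk : 0 ≤ w k) (hj : 0 ≤ w j) (h : 0 < w k + w j) :
    pooled b w k j ∈ Set.Icc (b j) (b k) := by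
  rw [pooled, Set.mem_Icc, le_div_iff₀ h, div_le_iff₀ h]
  constructor <;> nlinarith [mul_nonneg hk (sub_nonneg.mpr hb), mul_nonneg hj (sub_nonneg.mpr hb)]

lemma moveCost_nonneg (hb : F.IsInstance k b) (hk : 0 ≤ w k) (hj : 0 ≤ w j) {l : ℝ}
    (hl : l ∈ F.means) : 0 ≤ F.moveCost b w k j l :=
  add_nonneg (mul_nonneg hk (F.bregman_nonneg (hb.1 k) hl))
    (mul_nonneg hj (F.bregman_nonneg (hb.1 j) hl))

lemma moveCost_eq_gap_add (h : w k + w j ≠ 0) (l : ℝ) :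
    F.moveCost b w k j l = F.gap b w k j + (w k + w j) * F.bregman (pooled b w k j) l :=
  F.bregman_compensation l (pooled_spec h)

lemma pos_add_of_gap_pos (hk : 0 ≤ w k) (hj : 0 ≤ w j) (h : 0 < F.gap b w k j) :
    0 < w k + w j := by
  refine lt_of_le_of_ne (add_nonneg hk hj) fun e => h.ne' ?_
  have h1 : w k = 0 := by linarith
  have h2 : w j = 0 := by linarith
  simp [gap, moveCost, h1, h2]

/-- If one weight vanishes, the pooled mean is the mean of the other arm and nothing has to be paid.
-/
lemma pos_of_gap_pos (hk : 0 ≤ w k) (hj : 0 ≤ w j) (h : 0 < F.gap b w k j) :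
    0 < w k ∧ 0 < w j := by
  have hs := pos_add_of_gap_pos hk hj h
  constructor
  · refine lt_of_le_of_ne hk fun e => h.ne' ?_
    have : w j ≠ 0 := by rw [← e, zero_add] at hs; exact hs.ne'
    simp [gap, moveCost, pooled, ← e, this]
  · refine lt_of_le_of_ne hj fun e => h.ne' ?_
    have : w k ≠ 0 := by rw [← e, add_zero] at hs; exact hs.ne'
    simp [gap, moveCost, pooled, ← e, this]

lemma gap_le_moveCost (hb : F.IsInstance k b) (hk : 0 ≤ w k) (hj : 0 ≤ w j) {l : ℝ}
    (hl : l ∈ F.means) : F.gap b w k j ≤ F.moveCost b w k j l := by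
  by_cases hg : 0 < F.gap b w k j
  · have hs := pos_add_of_gap_pos hk hj hg
    rw [moveCost_eq_gap_add hs.ne']
    have := F.bregman_nonneg (hb.mem_of_mem_Icc (pooled_mem_Icc (hb.le j) hk hj hs)) hl
    nlinarith [mul_nonneg hs.le this]
  · exact (not_lt.mp hg).trans (moveCost_nonneg hb hk hj hl)

lemma gap_nonneg (hb : F.IsInstance k b) (hk : 0 ≤ w k) (hj : 0 ≤ w j) : 0 ≤ F.gap b w k j := by
  by_cases hs : 0 < w k + w j
  · exact moveCost_nonneg hb hk hj (hb.mem_of_mem_Icc (pooled_mem_Icc (hb.le j) hk hj hs))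
  · have h1 : w k = 0 := by linarith
    have h2 : w j = 0 := by linarith
    simp [gap, moveCost, h1, h2]

lemma gap_pos (hb : F.IsInstance k b) (hj : j ≠ k) (hwk : 0 < w k) (hwj : 0 < w j) :
    0 < F.gap b w k j := by
  have hs := add_pos hwk hwj
  have hm := hb.mem_of_mem_Icc (pooled_mem_Icc (hb.le j) hwk.le hwj.le hs)
  by_cases h : b k = pooled b w k j
  · have h' : b j ≠ pooled b w k j := fun e => (hb.2 j hj).ne (e.trans h.symm)
    exact add_pos_of_nonneg_of_pos (mul_nonneg hwk.le (F.bregman_nonneg (hb.1 k) hm))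
      (mul_pos hwj (F.bregman_pos (hb.1 j) hm h'))
  · exact add_pos_of_pos_of_nonneg (mul_pos hwk (F.bregman_pos (hb.1 k) hm h))
      (mul_nonneg hwj.le (F.bregman_nonneg (hb.1 j) hm))

lemma gap_smul (c : ℝ) (hc : c ≠ 0) : F.gap b (fun i => c * w i) k j = c * F.gap b w k j := by
  have : pooled b (fun i => c * w i) k j = pooled b w k j := by
    simp only [pooled]
    rw [← mul_div_mul_left _ (w k + w j) hc]
    ring_nf
  rw [gap, this, gap, moveCost, moveCost]
  ring

lemma ofReal_mul_d {u x l : ℝ} (hu : 0 ≤ u) (hx : x ∈ F.means) (hl : l ∈ F.means) :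
    ENNReal.ofReal u * F.d x l = ENNReal.ofReal (u * F.bregman x l) := by
  rw [F.d_eq_bregman hx hl, ENNReal.ofReal_mul hu]

/-- An alternative must have `λ_k < λ_j` strictly, so the common mean `l` is only a limit case: arm
`j` is sent to `l' > l`, and `l' → l` by continuity. -/
lemma value_le_moveCost (hb : F.IsInstance k b) (hw : ∀ i, 0 ≤ w i) (hj : j ≠ k) {l : ℝ}
    (hl : l ∈ F.means) : F.value k b w ≤ ENNReal.ofReal (F.moveCost b w k j l) := by
  classical
  have key : ∀ᶠ l' in 𝓝[>] l, F.value k b w ≤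
      ENNReal.ofReal (w k * F.bregman (b k) l + w j * F.bregman (b j) l') := by
    filter_upwards [self_mem_nhdsWithin, nhdsWithin_le_nhds (F.isOpen_means.mem_nhds hl)]
      with l' hlt hl'
    let lam : Fin n → ℝ := fun i => if i = k then l else if i = j then l' else b i
    have hlam : lam ∈ F.alt k := by
      refine ⟨fun i => ?_, j, ?_⟩
      · simp only [lam]
        split_ifs
        exacts [hl, hl', hb.1 i]
      · simpa [lam, hj] using hlt
    refine (iInf₂_le lam hlam).trans (le_of_eq ?_)
    have h0 : ∀ i, ENNReal.ofReal (w i) * F.d (b i) (lam i) =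
        ENNReal.ofReal (w i * F.bregman (b i) (lam i)) :=
      fun i => ofReal_mul_d (hw i) (hb.1 i) (hlam.1 i)
    have h1 : ∀ i, 0 ≤ w i * F.bregman (b i) (lam i) :=
      fun i => mul_nonneg (hw i) (F.bregman_nonneg (hb.1 i) (hlam.1 i))
    simp_rw [h0]
    rw [← ENNReal.ofReal_sum_of_nonneg fun i _ => h1 i,
      Finset.sum_eq_add k j hj.symm]
    · simp [lam, hj]
    · intro i _ hi
      simp [lam, hi.1, hi.2]
    · simp
    · simp
  refine ge_of_tendsto ?_ key
  refine (ENNReal.continuous_ofReal.tendsto _).comp (Tendsto.mono_left ?_ nhdsWithin_le_nhds)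
  have : ContinuousAt (fun l' => F.bregman (b j) l') l :=
    ContinuousAt.comp (f := fun l' => (b j, l')) (F.continuousAt_bregman (hb.1 j) hl)
      (by fun_prop)
  exact tendsto_const_nhds.add (tendsto_const_nhds.mul this)

/-- It suffices to move both arms to a common mean between theirs. -/
lemma exists_moveCost_le (hb : F.IsInstance k b) (hk : 0 ≤ w k) (hj : 0 ≤ w j) {x y : ℝ}
    (hx : x ∈ F.means) (hy : y ∈ F.means) (hxy : x ≤ y) :
    ∃ m ∈ Set.Icc (b j) (b k), F.moveCost b w k j m ≤
      w k * F.bregman (b k) x + w j * F.bregman (b j) y := by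
  have hjm := hb.1 j
  have hkm := hb.1 k
  -- The witness is the projection of `x` onto `[b j, b k]`.
  rcases le_total x (b j) with h1 | h1
  · refine ⟨b j, ⟨le_rfl, hb.le j⟩, add_le_add (mul_le_mul_of_nonneg_left
      (F.bregman_le_of_le_right hjm hx (hb.le j) h1) hk) (mul_le_mul_of_nonneg_left ?_ hj)⟩
    simpa using F.bregman_nonneg hjm hy
  rcases le_total x (b k) with h2 | h2
  · exact ⟨x, ⟨h1, h2⟩, add_le_add le_rfl (mul_le_mul_of_nonneg_left
      (F.bregman_le_of_le_left hx hy h1 hxy) hj)⟩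
  · refine ⟨b k, ⟨hb.le j, le_rfl⟩, add_le_add (mul_le_mul_of_nonneg_left ?_ hk)
      (mul_le_mul_of_nonneg_left (F.bregman_le_of_le_left hkm hy (hb.le j) (h2.trans hxy)) hj)⟩
    simpa using F.bregman_nonneg hkm hx

/-- An alternative in which `j` beats `k` pays at least for these two arms, and the other arms can
stay in place for free. Stating this through lower bounds `c` also covers a single arm, where the
value is `⊤`. -/
lemma ofReal_le_value_iff (hb : F.IsInstance k b) (hw : ∀ i, 0 ≤ w i) {c : ℝ} :
    ENNReal.ofReal c ≤ F.value k b w ↔ ∀ j, j ≠ k → c ≤ F.gap b w k j := by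
  constructor
  · intro h j hj
    by_cases hs : 0 < w k + w j
    · have hm := hb.mem_of_mem_Icc (pooled_mem_Icc (hb.le j) (hw k) (hw j) hs)
      exact (ENNReal.ofReal_le_ofReal_iff (gap_nonneg hb (hw k) (hw j))).mp
        (h.trans (value_le_moveCost hb hw hj hm))
    · have h1 : w k = 0 := by linarith [hw k, hw j]
      have h2 : w j = 0 := by linarith [hw k, hw j]
      have h3 := h.trans (value_le_moveCost hb hw hj (hb.1 k))
      simp only [moveCost, h1, h2, zero_mul, add_zero, ENNReal.ofReal_zero,
        nonpos_iff_eq_zero, ENNReal.ofReal_eq_zero] at h3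
      simpa [gap, moveCost, h1, h2] using h3
  · intro h
    refine le_iInf₂ fun lam hlam => ?_
    obtain ⟨hlam, j, hlt⟩ := hlam
    have hj : j ≠ k := fun e => by simp [e] at hlt
    obtain ⟨m, hm, hle⟩ := exists_moveCost_le hb (hw k) (hw j) (hlam k) (hlam j) hlt.le
    have h1 : ∀ i, 0 ≤ w i * F.bregman (b i) (lam i) :=
      fun i => mul_nonneg (hw i) (F.bregman_nonneg (hb.1 i) (hlam i))
    simp_rw [fun i => ofReal_mul_d (hw i) (hb.1 i) (hlam i)]
    rw [← ENNReal.ofReal_sum_of_nonneg fun i _ => h1 i]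
    refine ENNReal.ofReal_le_ofReal ?_
    calc c ≤ F.gap b w k j := h j hj
      _ ≤ F.moveCost b w k j m := gap_le_moveCost hb (hw k) (hw j) (hb.mem_of_mem_Icc hm)
      _ ≤ _ := hle
      _ ≤ _ := Finset.add_le_sum (f := fun i => w i * F.bregman (b i) (lam i))
          (fun i _ => h1 i) (Finset.mem_univ k) (Finset.mem_univ j) hj.symm

lemma value_ne_top (hb : F.IsInstance k b) (hw : ∀ i, 0 ≤ w i) (hj : j ≠ k) :
    F.value k b w ≠ ⊤ :=
  ne_top_of_le_ne_top ENNReal.ofReal_ne_top (value_le_moveCost hb hw hj (hb.1 k))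

lemma upperSemicontinuousOn_value (hb : F.IsInstance k b) :
    UpperSemicontinuousOn (fun w => F.value k b w) (stdSimplex ℝ (Fin n)) := by
  refine upperSemicontinuousOn_biInf fun lam hlam => ContinuousOn.upperSemicontinuousOn ?_
  have : ContinuousOn (fun w : Fin n → ℝ =>
      ∑ i, ENNReal.ofReal (w i * F.bregman (b i) (lam i))) (stdSimplex ℝ (Fin n)) := by
    refine Continuous.continuousOn (continuous_finsetSum _ fun i _ => ?_)
    exact ENNReal.continuous_ofReal.comp (by fun_prop)
  refine this.congr fun w hw => Finset.sum_congr rfl fun i _ => ?_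
  exact ofReal_mul_d (hw.1 i) (hb.1 i) (hlam.1 i)

lemma exists_isOptimalWeight (hb : F.IsInstance k b) : ∃ w, F.IsOptimalWeight k b w := by
  classical
  obtain ⟨w, hw, hmax⟩ := UpperSemicontinuousOn.exists_isMaxOn
    ⟨Pi.single k 1, single_mem_stdSimplex ℝ k⟩ (isCompact_stdSimplex ℝ (Fin n))
    (upperSemicontinuousOn_value hb)
  exact ⟨w, hw, fun v hv => hmax hv⟩

lemma IsOptimalWeight.charTime_eq (hw : F.IsOptimalWeight k b w) :
    F.charTime k b = (F.value k b w)⁻¹ := by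
  rw [charTime]
  congr 1
  exact le_antisymm (iSup₂_le hw.2) (le_iSup₂ (f := fun w _ => F.value k b w) w hw.1)

/-- With one arm there is no alternative, so the infimum over the empty set is `⊤`. -/
lemma charTime_eq_zero (h : ∀ j, j = k) : F.charTime k b = 0 := by
  have halt : F.alt k = ∅ := by
    ext lam
    simp only [alt, Set.mem_ofPred_eq, Set.mem_empty_iff_false, iff_false, not_and, not_exists]
    intro _ j
    simp [h j]
  rw [charTime, ENNReal.inv_eq_zero, ← top_le_iff]
  classical
  refine le_trans ?_ (le_iSup₂ (f := fun w _ => F.value k b w) (Pi.single k 1)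
    (single_mem_stdSimplex ℝ k))
  simp [value, halt]

lemma exists_pos_le_gap (hb : F.IsInstance k b) (hw : ∀ i, 0 < w i) :
    ∃ c > 0, ∀ j, j ≠ k → c ≤ F.gap b w k j := by
  have h : ∀ᶠ c in 𝓝[>] (0 : ℝ), ∀ j, j ≠ k → c ≤ F.gap b w k j := by
    refine eventually_all.mpr fun j => ?_
    by_cases hj : j = k
    · exact Eventually.of_forall fun _ h => absurd hj h
    · filter_upwards [nhdsWithin_le_nhds (Iio_mem_nhds (gap_pos hb hj (hw k) (hw j)))] with c hc _
      exact le_of_lt hc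
  obtain ⟨c, hc, hc'⟩ := (h.and self_mem_nhdsWithin).exists
  exact ⟨c, hc', hc⟩

lemma IsOptimalWeight.value_pos (hb : F.IsInstance k b) (hw : F.IsOptimalWeight k b w) :
    0 < F.value k b w := by
  have hn : (0 : ℝ) < n := Nat.cast_pos.mpr (Fin.pos k)
  have hpos : ∀ _ : Fin n, 0 < (1 : ℝ) / n := fun _ => by positivity
  obtain ⟨c, hc, hle⟩ := exists_pos_le_gap hb hpos
  refine (ENNReal.ofReal_pos.mpr hc).trans_le
    (((ofReal_le_value_iff hb fun i => (hpos i).le).mpr hle).trans (hw.2 _ ⟨fun i => (hpos i).le, ?_⟩))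
  simp [hn.ne']

lemma charTime_ne_top (hb : F.IsInstance k b) : F.charTime k b ≠ ⊤ := by
  obtain ⟨w, hw⟩ := exists_isOptimalWeight hb
  rw [hw.charTime_eq]
  exact ENNReal.inv_ne_top.mpr (hw.value_pos hb).ne'

/-- The optimal value is the largest rate at which the gaps grow with the total weight. -/
lemma IsOptimalWeight.le_mul_sum (hb : F.IsInstance k b) (hw : F.IsOptimalWeight k b w)
    (hj : j ≠ k) {v : Fin n → ℝ} (hv : ∀ i, 0 ≤ v i) {c : ℝ}
    (hc : ∀ i, i ≠ k → c ≤ F.gap b v k i) : c ≤ (F.value k b w).toReal * ∑ i, v i := by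
  by_cases hS : ∑ i, v i = 0
  · have h0 : ∀ i, v i = 0 := fun i =>
      (Finset.sum_eq_zero_iff_of_nonneg fun i _ => hv i).mp hS i (Finset.mem_univ i)
    have := hc j hj
    simp only [gap, moveCost, h0, zero_mul, add_zero] at this
    simpa [hS] using this
  · have hS' : 0 < ∑ i, v i :=
      lt_of_le_of_ne (Finset.sum_nonneg fun i _ => hv i) (Ne.symm hS)
    have hv' : ∀ i, 0 ≤ (∑ i, v i)⁻¹ * v i := fun i => mul_nonneg (inv_nonneg.mpr hS'.le) (hv i)
    have h1 : ENNReal.ofReal ((∑ i, v i)⁻¹ * c) ≤ F.value k b fun i => (∑ i, v i)⁻¹ * v i := by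
      refine (ofReal_le_value_iff hb hv').mpr fun i hi => ?_
      rw [gap_smul _ (inv_ne_zero hS)]
      exact mul_le_mul_of_nonneg_left (hc i hi) (inv_nonneg.mpr hS'.le)
    have h2 := h1.trans (hw.2 _ ⟨hv', by rw [← Finset.mul_sum, inv_mul_cancel₀ hS]⟩)
    rw [ENNReal.ofReal_le_iff_le_toReal (value_ne_top hb hw.1.1 hj)] at h2
    rw [inv_mul_le_iff₀ hS'] at h2
    linarith

lemma IsOptimalWeight.toReal_value_le_gap (hb : F.IsInstance k b) (hw : F.IsOptimalWeight k b w)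
    (hj : j ≠ k) : (F.value k b w).toReal ≤ F.gap b w k j :=
  (ofReal_le_value_iff hb hw.1.1).mp
    (ENNReal.ofReal_toReal (value_ne_top hb hw.1.1 hj)).le j hj

lemma IsOptimalWeight.toReal_value_pos (hb : F.IsInstance k b) (hw : F.IsOptimalWeight k b w)
    (hj : j ≠ k) : 0 < (F.value k b w).toReal :=
  ENNReal.toReal_pos (hw.value_pos hb).ne' (value_ne_top hb hw.1.1 hj)

/-- A weight vector of total mass one all of whose gaps reach the optimal value has no slack. -/
lemma IsOptimalWeight.gap_eq (hb : F.IsInstance k b) (hw : F.IsOptimalWeight k b w)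
    {v : Fin n → ℝ} (hv : v ∈ stdSimplex ℝ (Fin n))
    (hle : ∀ i, i ≠ k → (F.value k b w).toReal ≤ F.gap b v k i) (hj : j ≠ k) :
    F.gap b v k j = (F.value k b w).toReal := by
  classical
  set V := (F.value k b w).toReal with hV
  have hVpos : 0 < V := hw.toReal_value_pos hb hj
  refine le_antisymm (not_lt.mp fun hlt => ?_) (hle j hj)
  obtain ⟨hvk, hvj⟩ := pos_of_gap_pos (hv.1 k) (hv.1 j) (hVpos.trans hlt)
  set D := F.bregman (b j) (b k)
  have hD : 0 < D := F.bregman_pos (hb.1 j) (hb.1 k) (hb.2 j hj).ne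
  -- If the gap of `j` had slack, mass `s` could be taken from arm `j`. This lowers its gap by at
  -- most `s D`, since reaching a mean in `[b j, b k]` costs arm `j` at most `D`, and it leaves the
  -- other gaps alone. Total mass `1 - s` would then still reach `V`, contradicting `le_mul_sum`.
  set s := min (v j) ((F.gap b v k j - V) / D)
  have hs : 0 < s := lt_min hvj (div_pos (sub_pos.mpr hlt) hD)
  have hs1 : s ≤ v j := min_le_left _ _
  have hs2 : s * D ≤ F.gap b v k j - V := by
    rw [← le_div_iff₀ hD]; exact min_le_right _ _
  let u := Function.update v j (v j - s)
  have huk : u k = v k := Function.update_of_ne hj.symm _ _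
  have huj : u j = v j - s := Function.update_self _ _ _
  have hu : ∀ i, 0 ≤ u i := by
    intro i
    by_cases hi : i = j
    · rw [hi, huj]; linarith
    · simpa [u, hi] using hv.1 i
  have hsum : ∑ i, u i = 1 - s := by
    have := Finset.sum_update_of_mem (Finset.mem_univ j) v (v j - s)
    have h2 := Finset.add_sum_erase Finset.univ v (Finset.mem_univ j)
    rw [hv.2] at h2
    rw [Finset.sdiff_singleton_eq_erase] at this
    simp only [u]
    linarith
  have hc : ∀ i, i ≠ k → V ≤ F.gap b u k i := by
    intro i hi
    by_cases hij : i = j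
    · rw [hij]
      have hpos : 0 < u k + u j := by rw [huk]; linarith [hu j]
      have hm := pooled_mem_Icc (hb.le j) (hu k) (hu j) hpos
      have hmI := hb.mem_of_mem_Icc hm
      have h1 := gap_le_moveCost hb (hv.1 k) (hv.1 j) hmI
      have h2 : F.bregman (b j) (pooled b u k j) ≤ D :=
        F.bregman_le_of_le_left hmI (hb.1 k) hm.1 hm.2
      rw [gap, moveCost, huk, huj]
      rw [moveCost] at h1
      nlinarith [mul_le_mul_of_nonneg_left h2 hs.le]
    · have hui : u i = v i := Function.update_of_ne hij _ _
      simpa [gap, moveCost, pooled, huk, hui] using hle i hi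
  have := hw.le_mul_sum hb hj hu hc
  rw [hsum, ← hV] at this
  nlinarith [mul_pos hVpos hs]

/-- The costs are linear in the weights, so the midpoint `u` of two optima is optimal, and by
`gap_eq` it has no slack. Hence both optima have the same pooled mean as `u` for every pair `(k,
j)`. That mean fixes the ratio of the weights of `j` and `k`, and total mass one fixes the rest. -/
lemma IsOptimalWeight.unique (hb : F.IsInstance k b) {v : Fin n → ℝ}
    (hw : F.IsOptimalWeight k b w) (hv : F.IsOptimalWeight k b v) : v = w := by
  by_cases hn : ∀ j, j = k
  · have h1 : ∀ u ∈ stdSimplex ℝ (Fin n), u k = 1 := by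
      intro u hu
      rw [← hu.2, Finset.sum_eq_single_of_mem k (Finset.mem_univ k)
        fun i _ hi => absurd (hn i) hi]
    funext i
    rw [hn i, h1 w hw.1, h1 v hv.1]
  have hVeq : F.value k b v = F.value k b w := le_antisymm (hw.2 v hv.1) (hv.2 w hw.1)
  set V := (F.value k b w).toReal with hV
  let u : Fin n → ℝ := fun i => (1 / 2 : ℝ) * w i + (1 / 2) * v i
  have hu : u ∈ stdSimplex ℝ (Fin n) := by
    refine ⟨fun i => ?_, ?_⟩
    · have := hw.1.1 i
      have := hv.1.1 i
      positivity
    · simp only [u, Finset.sum_add_distrib, ← Finset.mul_sum, hw.1.2, hv.1.2]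
      norm_num
  have hmid : ∀ j l, F.moveCost b u k j l =
      (1 / 2) * F.moveCost b w k j l + (1 / 2) * F.moveCost b v k j l := by
    intro j l
    simp only [moveCost, u]
    ring
  have hmem : ∀ j, j ≠ k → ∀ u', F.IsOptimalWeight k b u' → 0 < F.gap b u' k j ∧
      0 < u' k + u' j ∧ pooled b u' k j ∈ F.means ∧ 0 < u' k ∧ 0 < u' j := by
    intro j hj u' hu'
    have h1 := (hu'.toReal_value_pos hb hj).trans_le (hu'.toReal_value_le_gap hb hj)
    have h2 := pos_add_of_gap_pos (hu'.1.1 k) (hu'.1.1 j) h1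
    exact ⟨h1, h2, hb.mem_of_mem_Icc (pooled_mem_Icc (hb.le j) (hu'.1.1 k) (hu'.1.1 j) h2),
      pos_of_gap_pos (hu'.1.1 k) (hu'.1.1 j) h1⟩
  have humem : ∀ j, j ≠ k → pooled b u k j ∈ F.means := by
    intro j hj
    have h1 := (hmem j hj w hw).2.2.2.1
    have h2 := hv.1.1 k
    have h3 : 0 < u k + u j := by
      have := hu.1 j
      simp only [u] at *
      linarith
    exact hb.mem_of_mem_Icc (pooled_mem_Icc (hb.le j) (hu.1 k) (hu.1 j) h3)
  have hle : ∀ j, j ≠ k → V ≤ F.gap b u k j := by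
    intro j hj
    have h1 := hw.toReal_value_le_gap hb hj
    have h2 := hv.toReal_value_le_gap hb hj
    have h3 := gap_le_moveCost hb (hw.1.1 k) (hw.1.1 j) (humem j hj)
    have h4 := gap_le_moveCost hb (hv.1.1 k) (hv.1.1 j) (humem j hj)
    rw [gap, hmid]
    rw [hVeq] at h2
    linarith
  have hcross : ∀ j, w k * v j = v k * w j := by
    intro j
    by_cases hj : j = k
    · rw [hj, mul_comm]
    have heq := hw.gap_eq hb hu hle hj
    rw [gap, hmid] at heq
    obtain ⟨-, hws, hwm, hwk, hwj⟩ := hmem j hj w hw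
    obtain ⟨-, hvs, hvm, hvk, hvj⟩ := hmem j hj v hv
    have h1 := hw.toReal_value_le_gap hb hj
    have h2 := hv.toReal_value_le_gap hb hj
    rw [hVeq] at h2
    have e1 := moveCost_eq_gap_add (F := F) (b := b) hws.ne' (pooled b u k j)
    have e2 := moveCost_eq_gap_add (F := F) (b := b) hvs.ne' (pooled b u k j)
    have n1 := F.bregman_nonneg hwm (humem j hj)
    have n2 := F.bregman_nonneg hvm (humem j hj)
    have p1 := mul_nonneg hws.le n1
    have p2 := mul_nonneg hvs.le n2
    have z1 : (w k + w j) * F.bregman (pooled b w k j) (pooled b u k j) = 0 := by linarith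
    have z2 : (v k + v j) * F.bregman (pooled b v k j) (pooled b u k j) = 0 := by linarith
    have q1 := F.bregman_eq_zero hwm (humem j hj) ((mul_eq_zero.mp z1).resolve_left hws.ne')
    have q2 := F.bregman_eq_zero hvm (humem j hj) ((mul_eq_zero.mp z2).resolve_left hvs.ne')
    have s1 := pooled_spec (b := b) hws.ne'
    have s2 := pooled_spec (b := b) hvs.ne'
    rw [q1] at s1
    rw [q2] at s2
    set m := pooled b u k j
    -- A pooled mean equal to `b j` would need zero weight on arm `k`.
    have hmj : m - b j ≠ 0 := by
      intro e
      have e' : m = b j := by linarith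
      rw [e'] at s1
      have := hb.2 j hj
      nlinarith [mul_pos hwk (sub_pos.mpr this)]
    have t1 : w j * (m - b j) = w k * (b k - m) := by linarith
    have t2 : v j * (m - b j) = v k * (b k - m) := by linarith
    refine mul_right_cancel₀ hmj ?_
    linear_combination w k * t2 - v k * t1
  have hk : w k = v k := by
    have h := Finset.sum_congr (rfl : (Finset.univ : Finset (Fin n)) = Finset.univ)
      fun j _ => hcross j
    rwa [← Finset.mul_sum, ← Finset.mul_sum, hw.1.2, hv.1.2, mul_one, mul_one] at h
  push Not at hn
  obtain ⟨j0, hj0⟩ := hn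
  have hwk := (hmem j0 hj0 w hw).2.2.2.1
  funext j
  have := hcross j
  rw [← hk] at this
  exact mul_left_cancel₀ hwk.ne' this

end ExpFamily

end TriBBAI

/-! ### Dependence of the optimal weights and the characteristic time on the instance -/

namespace TriBBAI

namespace ExpFamily

variable {F : ExpFamily} {n : ℕ} {k j : Fin n} {b w : Fin n → ℝ}

lemma IsInstance.eventually (hb : F.IsInstance k b) : ∀ᶠ a in 𝓝 b, F.IsInstance k a := by
  have h1 : ∀ᶠ a in 𝓝 b, ∀ i, a i ∈ F.means := eventually_all.mpr fun i =>
    (continuous_apply i).continuousAt.eventually (F.isOpen_means.mem_nhds (hb.1 i))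
  have h2 : ∀ᶠ a in 𝓝 b, ∀ i, i ≠ k → a i < a k := by
    refine eventually_all.mpr fun i => ?_
    by_cases hi : i = k
    · exact Eventually.of_forall fun _ h => absurd hi h
    · filter_upwards [(continuous_apply i).continuousAt.eventually_lt
        (continuous_apply k).continuousAt (hb.2 i hi)] with a ha _ using ha
  exact h1.and h2

lemma continuousAt_gap (hb : F.IsInstance k b) (hk : 0 ≤ w k) (hj : 0 ≤ w j)
    (h : 0 < w k + w j) : ContinuousAt (fun a => F.gap a w k j) b := by
  have hm := hb.mem_of_mem_Icc (pooled_mem_Icc (hb.le j) hk hj h)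
  have hp : Continuous fun a : Fin n → ℝ => pooled a w k j := by
    unfold pooled
    fun_prop
  have hd : ∀ i, ContinuousAt (fun a => F.bregman (a i) (pooled a w k j)) b := fun i =>
    ContinuousAt.comp (f := fun a : Fin n → ℝ => (a i, pooled a w k j))
      (F.continuousAt_bregman (hb.1 i) hm)
      ((continuous_apply i).continuousAt.prodMk hp.continuousAt)
  exact ((hd k).const_mul _).add ((hd j).const_mul _)

/-- The optimal value is lower semicontinuous in the instance. -/
lemma IsOptimalWeight.eventually_le_value (hb : F.IsInstance k b) (hw : F.IsOptimalWeight k b w)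
    (hj : j ≠ k) {c : ℝ} (hc : c < (F.value k b w).toReal) :
    ∀ᶠ a in 𝓝 b, ∀ v, F.IsOptimalWeight k a v → ENNReal.ofReal c ≤ F.value k a v := by
  have h : ∀ᶠ a in 𝓝 b, ∀ i, i ≠ k → c ≤ F.gap a w k i := by
    refine eventually_all.mpr fun i => ?_
    by_cases hi : i = k
    · exact Eventually.of_forall fun _ h => absurd hi h
    have hle := hw.toReal_value_le_gap hb hi
    have hpos := pos_add_of_gap_pos (hw.1.1 k) (hw.1.1 i)
      ((hw.toReal_value_pos hb hj).trans_le hle)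
    filter_upwards [(continuousAt_gap hb (hw.1.1 k) (hw.1.1 i) hpos).eventually
      (lt_mem_nhds (hc.trans_le hle))] with a ha _ using le_of_lt ha
  filter_upwards [h, hb.eventually] with a ha hia v hv
  exact ((ofReal_le_value_iff hia hw.1.1).mpr ha).trans (hv.2 w hw.1)

/-- The optimal weights depend continuously on the instance. -/
lemma IsOptimalWeight.tendsto (hb : F.IsInstance k b) (hw : F.IsOptimalWeight k b w)
    {W : (Fin n → ℝ) → Fin n → ℝ} (hW : ∀ᶠ a in 𝓝 b, F.IsOptimalWeight k a (W a)) :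
    Tendsto W (𝓝 b) (𝓝 w) := by
  -- Along an ultrafilter `W` converges in the compact simplex. By uniqueness it suffices that the
  -- limit `v` is optimal at `b`.
  refine tendsto_iff_ultrafilter _ _ _ |>.mpr fun g hg => ?_
  have hW' := hW.filter_mono hg
  have hin : ∀ᶠ a in (g : Filter (Fin n → ℝ)), W a ∈ stdSimplex ℝ (Fin n) :=
    hW'.mono fun a ha => ha.1
  obtain ⟨v, hv, hlim⟩ := (isCompact_stdSimplex ℝ (Fin n)).ultrafilter_le_nhds (g.map W)
    (le_principal_iff.mpr hin)
  have hlim : Tendsto W g (𝓝 v) := hlim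
  suffices F.IsOptimalWeight k b v by rwa [← hw.unique hb this]
  refine ⟨hv, fun u hu => (hw.2 u hu).trans ?_⟩
  by_cases hn : ∀ j, j = k
  · have : F.value k b v = ⊤ := by
      refine top_le_iff.mp (le_iInf₂ fun lam hlam => ?_)
      obtain ⟨-, j, hlt⟩ := hlam
      simp [hn j] at hlt
    rw [this]
    exact le_top
  push Not at hn
  obtain ⟨j0, hj0⟩ := hn
  rw [← ENNReal.ofReal_toReal (value_ne_top hb hw.1.1 hj0), ofReal_le_value_iff hb hv.1]
  intro j hj
  refine le_of_forall_lt fun c hc => ?_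
  obtain ⟨c', hcc', hc'⟩ := exists_between hc
  refine hcc'.trans_le ?_
  by_cases hc0 : c' ≤ 0
  · exact hc0.trans (gap_nonneg hb (hv.1 k) (hv.1 j))
  push Not at hc0
  have hev := (hw.eventually_le_value hb hj0 hc').filter_mono hg
  -- The pooled mean degenerates when `v k + v j = 0`, so the limit is taken in the cost at a fixed
  -- `l`. Positivity of `c'` then excludes that case.
  have hlimcost : ∀ l ∈ F.means, Tendsto (fun a => F.moveCost a (W a) k j l) g
      (𝓝 (F.moveCost b v k j l)) := by
    intro l hl
    have hcoord : ∀ i, Tendsto (fun a => W a i) g (𝓝 (v i)) := fun i =>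
      ((continuous_apply i).tendsto v).comp hlim
    have hd : ∀ i, Tendsto (fun a : Fin n → ℝ => F.bregman (a i) l) g (𝓝 (F.bregman (b i) l)) := by
      intro i
      have : ContinuousAt (fun a : Fin n → ℝ => F.bregman (a i) l) b :=
        ContinuousAt.comp (f := fun a : Fin n → ℝ => (a i, l))
          (F.continuousAt_bregman (hb.1 i) hl)
          ((continuous_apply i).continuousAt.prodMk continuousAt_const)
      exact Tendsto.mono_left this hg
    exact ((hcoord k).mul (hd k)).add ((hcoord j).mul (hd j))
  have hcost : ∀ l ∈ F.means, c' ≤ F.moveCost b v k j l := by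
    intro l hl
    refine ge_of_tendsto (hlimcost l hl) ?_
    filter_upwards [hev, hW', hb.eventually.filter_mono hg] with a ha hWa hia
    exact ((ofReal_le_value_iff hia hWa.1.1).mp (ha _ hWa) j hj).trans
      (gap_le_moveCost hia (hWa.1.1 k) (hWa.1.1 j) hl)
  by_cases hs : 0 < v k + v j
  · exact hcost _ (hb.mem_of_mem_Icc (pooled_mem_Icc (hb.le j) (hv.1 k) (hv.1 j) hs))
  · have h1 : v k = 0 := by linarith [hv.1 k, hv.1 j]
    have h2 : v j = 0 := by linarith [hv.1 k, hv.1 j]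
    have := hcost _ (hb.1 k)
    simp only [moveCost, h1, h2, zero_mul, add_zero] at this
    linarith

/-- The characteristic time is upper semicontinuous in the instance. -/
lemma eventually_charTime_le (hb : F.IsInstance k b) {κ : ℝ} (hκ : 0 < κ) :
    ∀ᶠ a in 𝓝 b, (F.charTime k a).toReal ≤ (F.charTime k b).toReal + κ := by
  obtain ⟨w, hw⟩ := exists_isOptimalWeight hb
  by_cases hn : ∀ j, j = k
  · refine Eventually.of_forall fun a => ?_
    rw [charTime_eq_zero hn, charTime_eq_zero hn]
    simpa using hκ.le
  push Not at hn
  obtain ⟨j, hj⟩ := hn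
  have hV := hw.toReal_value_pos hb hj
  set V := (F.value k b w).toReal with hVdef
  have hlt : (V⁻¹ + κ)⁻¹ < V := by
    rw [inv_lt_comm₀ (by positivity) hV]
    linarith
  filter_upwards [hw.eventually_le_value hb hj hlt, hb.eventually] with a ha hia
  obtain ⟨v, hv⟩ := exists_isOptimalWeight hia
  have h1 := ha v hv
  rw [hv.charTime_eq, hw.charTime_eq, ENNReal.toReal_inv, ENNReal.toReal_inv, ← hVdef]
  rw [ENNReal.ofReal_le_iff_le_toReal (value_ne_top hia hv.1.1 hj)] at h1
  exact inv_le_of_inv_le₀ (by positivity) h1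

/-- This caps the targets of all batches at once, whatever nearby instance each of them is computed
from. -/
lemma eventually_weight_mul_charTime_le (hb : F.IsInstance k b) (hw : F.IsOptimalWeight k b w)
    {W : (Fin n → ℝ) → Fin n → ℝ} (hW : ∀ᶠ a in 𝓝 b, F.IsOptimalWeight k a (W a))
    {κ : ℝ} (hκ : 0 < κ) :
    ∀ᶠ a in 𝓝 b, ∀ i, W a i * (F.charTime k a).toReal ≤ w i * (F.charTime k b).toReal + κ := by
  set T := (F.charTime k b).toReal
  have hT : 0 ≤ T := ENNReal.toReal_nonneg
  refine eventually_all.mpr fun i => ?_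
  have h1 : ∀ᶠ r in 𝓝[>] (0 : ℝ), (w i + r) * (T + r) < w i * T + κ := by
    have : ContinuousAt (fun r : ℝ => (w i + r) * (T + r)) 0 := by fun_prop
    refine nhdsWithin_le_nhds (this.eventually (gt_mem_nhds ?_))
    simpa using hκ
  obtain ⟨r, hr, hr0⟩ := (h1.and self_mem_nhdsWithin).exists
  have hr0 : 0 < r := hr0
  have h2 : Tendsto (fun a => W a i) (𝓝 b) (𝓝 (w i)) :=
    ((continuous_apply i).tendsto w).comp (hw.tendsto hb hW)
  filter_upwards [h2.eventually (gt_mem_nhds (show w i < w i + r by linarith)),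
    eventually_charTime_le hb hr0] with a ha1 ha2
  refine le_trans ?_ hr.le
  have := hw.1.1 i
  exact mul_le_mul (le_of_lt ha1) ha2 ENNReal.toReal_nonneg (by positivity)

end ExpFamily

end TriBBAI

/-! ### The run of the algorithm on concentrated rewards -/

namespace TriBBAI

namespace ExpFamily

variable {F : ExpFamily} {n : ℕ} {k j : Fin n} {b w : Fin n → ℝ}

lemma IsOptimalWeight.one_le_charTime_mul (hb : F.IsInstance k b) (hw : F.IsOptimalWeight k b w)
    (hj : j ≠ k) {l : ℝ} (hl : l ∈ F.means) :
    1 ≤ (F.charTime k b).toReal * F.moveCost b w k j l := by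
  have hV := hw.toReal_value_pos hb hj
  have h1 := (hw.toReal_value_le_gap hb hj).trans (gap_le_moveCost hb (hw.1.1 k) (hw.1.1 j) hl)
  rw [hw.charTime_eq, ENNReal.toReal_inv, inv_mul_eq_div]
  exact (one_le_div hV).mpr h1

/-- Sampling proportionally to the optimal weights of an instance `b`, when the empirical means
`y` of two arms are further apart than their means in `b`. -/
lemma IsOptimalWeight.le_pair_cost (hb : F.IsInstance k b) (hw : F.IsOptimalWeight k b w)
    (hj : j ≠ k) {y N : Fin n → ℝ} {h Δ c m : ℝ} (hyk : y k ∈ F.means) (hyj : y j ∈ F.means)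
    (hh : 0 ≤ h) (hΔ : 0 < Δ) (hbΔ : b k - b j ≤ Δ) (hk : b k + h ≤ y k) (hj' : y j + h ≤ b j)
    (hc : 0 ≤ c) (hN : ∀ i, c * (w i * (F.charTime k b).toReal) ≤ N i)
    (hm : m ∈ Set.Icc (y j) (y k)) :
    (1 + h / Δ) * c ≤ N k * F.bregman (y k) m + N j * F.bregman (y j) m := by
  set s := h / Δ
  set T := (F.charTime k b).toReal
  have hT : 0 ≤ T := ENNReal.toReal_nonneg
  have hs : 0 ≤ s := by positivity
  have hsΔ : s * Δ = h := div_mul_cancel₀ _ hΔ.ne'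
  have hmI : m ∈ F.means := F.ordConnected_means.out hyj hyk hm
  have hN0 : ∀ i, 0 ≤ N i := fun i =>
    (mul_nonneg hc (mul_nonneg (hw.1.1 i) hT)).trans (hN i)
  have up : ∀ l, b j ≤ l → l ≤ b k → (1 + s) * F.bregman (b k) l ≤ F.bregman (y k) l := by
    intro l h1 h2
    refine F.bregman_stretch (hb.1 k) (hb.mem_of_mem_Icc ⟨h1, h2⟩) hyk hs ?_
    have h3 : s * (b k - l) ≤ h := by
      rw [← hsΔ]
      exact mul_le_mul_of_nonneg_left (by linarith) hs
    nlinarith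
  have down : ∀ l, b j ≤ l → l ≤ b k → (1 + s) * F.bregman (b j) l ≤ F.bregman (y j) l := by
    intro l h1 h2
    refine F.bregman_stretch (hb.1 j) (hb.mem_of_mem_Icc ⟨h1, h2⟩) hyj hs ?_
    have h3 : s * (l - b j) ≤ h := by
      rw [← hsΔ]
      exact mul_le_mul_of_nonneg_left (by linarith) hs
    nlinarith
  -- The point `m` may fall outside `[b j, b k]`, where optimality of `w` is to be used. Its
  -- projection `l` serves instead: the arm whose mean in `b` equals `l` contributes zero, and for
  -- the other one `l` is nearer than `m`.
  have key : ∃ l ∈ Set.Icc (b j) (b k), (1 + s) * F.bregman (b k) l ≤ F.bregman (y k) m ∧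
      (1 + s) * F.bregman (b j) l ≤ F.bregman (y j) m := by
    have hbjk := hb.le j
    rcases le_total m (b j) with h1 | h1
    · refine ⟨b j, ⟨le_rfl, hbjk⟩, (up _ le_rfl hbjk).trans ?_, ?_⟩
      · exact F.bregman_le_of_le_right (hb.1 j) hmI (by linarith) h1
      · rw [bregman_self, mul_zero]
        exact F.bregman_nonneg hyj hmI
    rcases le_total m (b k) with h2 | h2
    · exact ⟨m, ⟨h1, h2⟩, up _ h1 h2, down _ h1 h2⟩
    · refine ⟨b k, ⟨hbjk, le_rfl⟩, ?_, (down _ hbjk le_rfl).trans ?_⟩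
      · rw [bregman_self, mul_zero]
        exact F.bregman_nonneg hyk hmI
      · exact F.bregman_le_of_le_left (hb.1 k) hmI (by linarith) h2
  obtain ⟨l, hl, hlk, hlj⟩ := key
  have hlI := hb.mem_of_mem_Icc hl
  have h1 := hw.one_le_charTime_mul hb hj hlI
  have dk := F.bregman_nonneg (hb.1 k) hlI
  have dj := F.bregman_nonneg (hb.1 j) hlI
  calc (1 + s) * c ≤ (1 + s) * c * (T * F.moveCost b w k j l) :=
        le_mul_of_one_le_right (by positivity) h1
    _ = (c * (w k * T)) * ((1 + s) * F.bregman (b k) l)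
          + (c * (w j * T)) * ((1 + s) * F.bregman (b j) l) := by
        rw [moveCost]; ring
    _ ≤ N k * F.bregman (y k) m + N j * F.bregman (y j) m := by
        have := hN0 k
        have := hN0 j
        gcongr
        · exact hN k
        · exact hN j

end ExpFamily

section Algorithm

variable {F : ExpFamily} {n : ℕ} (R : Rules F n) (p : Params) {x : Fin n → ℕ → ℝ}

lemma stageTwo_induction {Q : (Fin n → ℕ) → Prop} (hQ : ∀ N, Q N → Q (nextPulls R p x N)) :
    ∀ (r : ℕ) (N : Fin n → ℕ) (w : Fin n → ℝ), Q N → Q (stageTwo R p x r N w)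
  | 0, _, _, h => h
  | r + 1, N, w, h => by
      rw [stageTwo]
      split_ifs
      · exact hQ N h
      · exact stageTwo_induction hQ r _ _ (hQ N h)

/-- Stage II runs at least one batch, so it is enough that the property holds after the first one,
whenever the stage is left. -/
lemma stageTwo_induction_of_pos {Q : (Fin n → ℕ) → Prop}
    (hQ : ∀ N, Q N → Q (nextPulls R p x N)) {r : ℕ} (hr : 0 < r) {N : Fin n → ℕ}
    (w : Fin n → ℝ) (h : Q (nextPulls R p x N)) : Q (stageTwo R p x r N w) := by
  obtain ⟨r, rfl⟩ := Nat.exists_eq_succ_of_ne_zero hr.ne'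
  rw [stageTwo]
  split_ifs
  · exact h
  · exact stageTwo_induction R p hQ r _ _ h

lemma target_le (N : Fin n → ℕ) (i : Fin n) (hL : 0 ≤ p.L₂) : target R p x N i ≤ p.L₂ := by
  rw [target]
  refine (ENNReal.toReal_mono ENNReal.ofReal_ne_top (min_le_right _ _)).trans ?_
  rw [ENNReal.toReal_ofReal hL]

lemma nextPulls_le_iff (N : Fin n → ℕ) (i : Fin n) (B : ℕ) :
    nextPulls R p x N i ≤ B ↔ N i ≤ B ∧ target R p x N i ≤ B := by
  rw [nextPulls, max_le_iff, Nat.ceil_le]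

lemma le_nextPulls (N : Fin n → ℕ) (i : Fin n) : N i ≤ nextPulls R p x N i := le_max_left _ _

lemma target_le_nextPulls (N : Fin n → ℕ) (i : Fin n) :
    target R p x N i ≤ nextPulls R p x N i :=
  (Nat.le_ceil _).trans (Nat.cast_le.mpr (le_max_right _ _))

lemma explore_le (hL : 0 ≤ p.L₂) (i : Fin n) :
    explore R p x i ≤ max ⌈p.L₁⌉₊ ⌈p.L₂⌉₊ := by
  refine stageTwo_induction R p (Q := fun N => ∀ i, N i ≤ max ⌈p.L₁⌉₊ ⌈p.L₂⌉₊) ?_ _ _ _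
    (fun i => le_max_left _ _) i
  intro N hN i
  refine (nextPulls_le_iff R p N i _).mpr ⟨hN i, (target_le R p N i hL).trans ?_⟩
  exact (Nat.le_ceil _).trans (Nat.cast_le.mpr (le_max_right _ _))

/-- The empirical means of each arm stay within `η` of its mean from the `S`-th pull on. -/
def Concentrated (μ : Fin n → ℝ) (x : Fin n → ℕ → ℝ) (S : ℕ) (η : ℝ) : Prop :=
  ∀ i s, S ≤ s → |(∑ r ∈ Finset.range s, x i r) / (s : ℝ) - μ i| ≤ η

variable {R p} {μ : Fin n → ℝ} {k : Fin n} {S : ℕ} {η : ℝ} {N : Fin n → ℕ}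

lemma Concentrated.empMean_near (hx : Concentrated μ x S η) (hN : ∀ i, S ≤ N i) (i : Fin n) :
    |empMean x N i - μ i| ≤ η := hx i _ (hN i)

lemma Concentrated.leader_eq (hx : Concentrated μ x S η) (hN : ∀ i, S ≤ N i)
    (hη : ∀ i, i ≠ k → 2 * η < μ k - μ i) : R.leader (empMean x N) = k := by
  by_contra hne
  have h1 := R.leader_max (empMean x N) k
  have h2 := abs_le.mp (hx.empMean_near hN k)
  have h3 := abs_le.mp (hx.empMean_near hN (R.leader (empMean x N)))
  have h4 := hη _ hne
  linarith [h2.1, h3.2]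

lemma target_eq {b : Fin n → ℝ} (hk : R.leader (empMean x N) = k)
    (hb : shifted R p x N = b) (hT : R.time k b ≠ ⊤) (i : Fin n)
    (h0 : 0 ≤ p.α * R.weight k b i * Real.log (1 / p.δ)) (hL : 0 ≤ p.L₂) :
    target R p x N i =
      min (p.α * Real.log (1 / p.δ) * (R.weight k b i * (R.time k b).toReal)) p.L₂ := by
  rw [target, nextWeight, hk, hb, ENNReal.toReal_min (ENNReal.mul_ne_top ENNReal.ofReal_ne_top hT)
    ENNReal.ofReal_ne_top, ENNReal.toReal_mul, ENNReal.toReal_ofReal h0, ENNReal.toReal_ofReal hL]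
  congr 1
  ring

/-- What a batch of Stage II relies on, at an instance `b` near the true one. -/
structure IsReliable (R : Rules F n) (k : Fin n) (b B : Fin n → ℝ) : Prop where
  inst : F.IsInstance k b
  weight_mul_le : ∀ i, R.weight k b i * (F.charTime k b).toReal ≤ B i

lemma IsReliable.isOptimalWeight {b B : Fin n → ℝ} (h : IsReliable R k b B) :
    F.IsOptimalWeight k b (R.weight k b) :=
  R.weight_opt k b h.inst (ExpFamily.exists_isOptimalWeight h.inst)

lemma eventually_isReliable (hμ : F.IsInstance k μ) {w : Fin n → ℝ}
    (hw : F.IsOptimalWeight k μ w) {κ : ℝ} (hκ : 0 < κ) :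
    ∀ᶠ b in 𝓝 μ, IsReliable R k b fun i => w i * (F.charTime k μ).toReal + κ := by
  have hW : ∀ᶠ b in 𝓝 μ, F.IsOptimalWeight k b (R.weight k b) :=
    hμ.eventually.mono fun b hb => R.weight_opt k b hb (ExpFamily.exists_isOptimalWeight hb)
  filter_upwards [hμ.eventually, ExpFamily.eventually_weight_mul_charTime_le hμ hw hW hκ]
    with b h1 h2 using ⟨h1, h2⟩

/-- The standing assumptions under which the run of the algorithm on concentrated rewards is
controlled: `B` bounds `w^* T^*` near `μ`. -/
structure GoodRun (R : Rules F n) (p : Params) (μ B : Fin n → ℝ) (k : Fin n) (x : Fin n → ℕ → ℝ)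
    (S : ℕ) (η : ℝ) : Prop where
  concentrated : Concentrated μ x S η
  gap : ∀ i, i ≠ k → 2 * η < μ k - μ i
  shift : p.ε = 4 * η
  nonneg : 0 ≤ η
  mem : ∀ y : Fin n → ℝ, (∀ i, |y i - μ i| ≤ 5 * η) → IsReliable R k y B
  α_nonneg : 0 ≤ p.α
  log_nonneg : 0 ≤ Real.log (1 / p.δ)
  L₂_ge : ∀ i, p.α * Real.log (1 / p.δ) * B i ≤ p.L₂
  L₂_nonneg : 0 ≤ p.L₂
  start : S ≤ ⌈p.L₁⌉₊

namespace GoodRun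

variable {B : Fin n → ℝ}

lemma leader_eq (G : GoodRun R p μ B k x S η) (hN : ∀ i, S ≤ N i) :
    R.leader (empMean x N) = k :=
  G.concentrated.leader_eq hN G.gap

lemma shifted_leader (G : GoodRun R p μ B k x S η) (hN : ∀ i, S ≤ N i) :
    shifted R p x N k = empMean x N k - 4 * η := by
  rw [shifted, G.leader_eq hN, if_pos rfl, G.shift]

lemma shifted_of_ne (G : GoodRun R p μ B k x S η) (hN : ∀ i, S ≤ N i) {i : Fin n} (hi : i ≠ k) :
    shifted R p x N i = empMean x N i + 4 * η := by
  rw [shifted, G.leader_eq hN, if_neg hi, G.shift]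

lemma isReliable_shifted (G : GoodRun R p μ B k x S η) (hN : ∀ i, S ≤ N i) :
    IsReliable R k (shifted R p x N) B := by
  -- The radius `5 * η` is the shift `4 * η` plus the sampling error `η`.
  refine G.mem _ fun i => ?_
  have h := abs_le.mp (G.concentrated.empMean_near hN i)
  have h0 := G.nonneg
  rw [abs_le]
  by_cases hi : i = k
  · subst hi
    rw [G.shifted_leader hN]
    constructor <;> linarith [h.1, h.2]
  · rw [G.shifted_of_ne hN hi]
    constructor <;> linarith [h.1, h.2]

/-- Needed because `R.div` is prescribed only between means of the family. -/
lemma empMean_mem (G : GoodRun R p μ B k x S η) (hN : ∀ i, S ≤ N i) (i : Fin n) :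
    empMean x N i ∈ F.means :=
  (G.mem (empMean x N) fun i =>
    (G.concentrated.empMean_near hN i).trans (by linarith [G.nonneg])).inst.1 i

lemma target_eq (G : GoodRun R p μ B k x S η) (hN : ∀ i, S ≤ N i) (i : Fin n) :
    target R p x N i = p.α * Real.log (1 / p.δ) *
      (R.weight k (shifted R p x N) i * (F.charTime k (shifted R p x N)).toReal) := by
  have hr := G.isReliable_shifted hN
  have ht := R.time_eq k _ hr.inst
  have hw := hr.isOptimalWeight.1.1 i
  have hα := G.α_nonneg
  have hL := G.log_nonneg
  rw [TriBBAI.target_eq (G.leader_eq hN) rfl (ht ▸ ExpFamily.charTime_ne_top hr.inst) i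
    (by positivity) G.L₂_nonneg, ht, min_eq_left]
  exact (mul_le_mul_of_nonneg_left (hr.weight_mul_le i) (by positivity)).trans (G.L₂_ge i)

lemma target_le (G : GoodRun R p μ B k x S η) (hN : ∀ i, S ≤ N i) (i : Fin n) :
    target R p x N i ≤ p.α * Real.log (1 / p.δ) * B i := by
  rw [G.target_eq hN]
  exact mul_le_mul_of_nonneg_left ((G.isReliable_shifted hN).weight_mul_le i)
    (mul_nonneg G.α_nonneg G.log_nonneg)

lemma le_explore (G : GoodRun R p μ B k x S η) (i : Fin n) : S ≤ explore R p x i :=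
  stageTwo_induction R p (Q := fun N => ∀ i, S ≤ N i)
    (fun N hN i => (hN i).trans (le_nextPulls R p N i)) _ _ _ (fun _ => G.start) i

/-- Targets are total counts, so successive batches do not add up: all of them stay below one common
cap. -/
lemma explore_le (G : GoodRun R p μ B k x S η) (i : Fin n) :
    explore R p x i ≤ max ⌈p.L₁⌉₊ ⌈p.α * Real.log (1 / p.δ) * B i⌉₊ := by
  refine (stageTwo_induction R p (Q := fun N => ∀ i, S ≤ N i ∧
    N i ≤ max ⌈p.L₁⌉₊ ⌈p.α * Real.log (1 / p.δ) * B i⌉₊) ?_ _ _ _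
    (fun i => ⟨G.start, le_max_left _ _⟩) i).2
  intro N hN i
  refine ⟨(hN i).1.trans (le_nextPulls R p N i), (nextPulls_le_iff R p N i _).mpr ⟨(hN i).2, ?_⟩⟩
  refine (G.target_le (fun i => (hN i).1) i).trans ((Nat.le_ceil _).trans ?_)
  exact Nat.cast_le.mpr (le_max_right _ _)

/-- Here `b` is the instance of the first batch. Later batches only raise the counts, so its targets
remain met. The margin `3 * η` is the shift `4 * η` less the sampling error. -/
lemma exists_le_explore (G : GoodRun R p μ B k x S η) (hr : 1 ≤ Real.log (1 / p.δ)) :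
    ∃ b, IsReliable R k b B ∧ b k + 3 * η ≤ μ k ∧ (∀ j, j ≠ k → μ j + 3 * η ≤ b j) ∧
      ∀ i, p.α * Real.log (1 / p.δ) * (R.weight k b i * (F.charTime k b).toReal) ≤
        explore R p x i := by
  have hS : ∀ _ : Fin n, S ≤ ⌈p.L₁⌉₊ := fun _ => G.start
  set N₀ : Fin n → ℕ := fun _ => ⌈p.L₁⌉₊
  refine ⟨shifted R p x N₀, G.isReliable_shifted hS, ?_, fun j hj => ?_, ?_⟩
  · have := abs_le.mp (G.concentrated.empMean_near hS k)
    rw [G.shifted_leader hS]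
    linarith [this.2]
  · have := abs_le.mp (G.concentrated.empMean_near hS j)
    rw [G.shifted_of_ne hS hj]
    linarith [this.1]
  · have key : ∀ i, target R p x N₀ i ≤ explore R p x i := by
      refine stageTwo_induction_of_pos R p
        (Q := fun N => ∀ i, target R p x N₀ i ≤ N i) ?_ (Nat.floor_pos.mpr hr) _ ?_
      · exact fun N hN i => (hN i).trans (Nat.cast_le.mpr (le_nextPulls R p N i))
      · exact fun i => target_le_nextPulls R p N₀ i
    exact fun i => G.target_eq hS i ▸ key i

/-- The first-batch instance is inside the true one by `3 * η` on each side, and the final empirical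
means are off by at most `η`. So `le_pair_cost` applies with `h = 2 * η`, which yields the extra
factor `1 + 2 * η / Δ`. -/
lemma stops (G : GoodRun R p μ B k x S η) (hS : 0 < S) (hr : 1 ≤ Real.log (1 / p.δ)) {Δ : ℝ}
    (hΔ : 0 < Δ) (hμΔ : ∀ i, μ k - μ i ≤ Δ)
    (hβ : p.β ((∑ i, explore R p x i : ℕ) : ℝ) (p.δ / 2) ≤
      (1 + 2 * η / Δ) * (p.α * Real.log (1 / p.δ))) :
    stops R p x (explore R p x) := by
  set N := explore R p x with hNdef
  have hN : ∀ i, S ≤ N i := G.le_explore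
  have hpos : ∀ i, (0 : ℝ) < N i := fun i => Nat.cast_pos.mpr (hS.trans_le (hN i))
  rw [TriBBAI.stops, G.leader_eq hN]
  intro j hj
  obtain ⟨b, hb, hbk, hbj, hle⟩ := G.exists_le_explore hr
  have hη := G.nonneg
  have hk := abs_le.mp (G.concentrated.empMean_near hN k)
  have hj' := abs_le.mp (G.concentrated.empMean_near hN j)
  have hlt : empMean x N j ≤ empMean x N k := by linarith [G.gap j hj, hk.1, hj'.2]
  have hm : ExpFamily.pooled (empMean x N) (fun i => (N i : ℝ)) k j ∈
      Set.Icc (empMean x N j) (empMean x N k) :=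
    ExpFamily.pooled_mem_Icc hlt (hpos k).le (hpos j).le (add_pos (hpos k) (hpos j))
  have hmI := F.ordConnected_means.out (G.empMean_mem hN j) (G.empMean_mem hN k) hm
  have hα := G.α_nonneg
  have hlog := G.log_nonneg
  have key := hb.isOptimalWeight.le_pair_cost hb.inst hj (y := empMean x N)
    (N := fun i => (N i : ℝ)) (h := 2 * η) (Δ := Δ) (c := p.α * Real.log (1 / p.δ))
    (G.empMean_mem hN k) (G.empMean_mem hN j) (by linarith) hΔ
    (by linarith [hμΔ j, hbj j hj]) (by linarith [hk.1]) (by linarith [hj'.2, hbj j hj])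
    (by positivity) hle hm
  have hd : ∀ i, R.div (empMean x N i)
      (ExpFamily.pooled (empMean x N) (fun i => (N i : ℝ)) k j) * (N i : ℝ≥0∞) =
      ENNReal.ofReal (N i * F.bregman (empMean x N i)
        (ExpFamily.pooled (empMean x N) (fun i => (N i : ℝ)) k j)) := by
    intro i
    rw [R.div_eq _ (G.empMean_mem hN i) _ hmI, ← ExpFamily.ofReal_mul_d (hpos i).le
      (G.empMean_mem hN i) hmI, ENNReal.ofReal_natCast, mul_comm]
  have hZ : chernoffZ R x N k j = ENNReal.ofReal
      (N k * F.bregman (empMean x N k)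
        (ExpFamily.pooled (empMean x N) (fun i => (N i : ℝ)) k j) +
      N j * F.bregman (empMean x N j)
        (ExpFamily.pooled (empMean x N) (fun i => (N i : ℝ)) k j)) := by
    rw [ENNReal.ofReal_add
      (mul_nonneg (hpos k).le (F.bregman_nonneg (G.empMean_mem hN k) hmI))
      (mul_nonneg (hpos j).le (F.bregman_nonneg (G.empMean_mem hN j) hmI)), ← hd k, ← hd j]
    rfl
  rw [hZ]
  exact ENNReal.ofReal_le_ofReal (hβ.trans key)

lemma numPulls_le (G : GoodRun R p μ B k x S η) (hst : TriBBAI.stops R p x (explore R p x)) :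
    numPulls R p x ≤ ∑ i, max ⌈p.L₁⌉₊ ⌈p.α * Real.log (1 / p.δ) * B i⌉₊ := by
  rw [numPulls, finalPulls, if_pos hst]
  exact Finset.sum_le_sum fun i _ => G.explore_le i

end GoodRun

end Algorithm

end TriBBAI

/-! ### Concentration of the empirical means -/

namespace TriBBAI

namespace ExpFamily

variable {F : ExpFamily}

/-- Second-order Taylor bound. One constant `K` serves as curvature bound and as inverse radius, and
every large `K` works, so a single `K` can be chosen for all arms. -/
lemma eventually_logPartition_le {θ : ℝ} (hθ : θ ∈ F.Θ) :
    ∀ᶠ K : ℝ in atTop, ∀ t : ℝ, |t| ≤ 1 / K →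
      θ + t ∈ F.Θ ∧ F.logPartition (θ + t) - F.logPartition θ ≤ t * F.mean θ + K * t ^ 2 := by
  obtain ⟨q, hq⟩ := F.analyticAt_logPartition hθ
  obtain ⟨C, hC⟩ := (hq.isBigO_sub_partialSum_pow 2).bound
  have hmem : ∀ᶠ t in 𝓝 (0 : ℝ), θ + t ∈ F.Θ := by
    have : ContinuousAt (fun t : ℝ => θ + t) 0 := by fun_prop
    refine this.eventually (F.isOpen_param.mem_nhds ?_)
    simpa using hθ
  obtain ⟨r, hr, hball⟩ := Metric.eventually_nhds_iff.mp (hC.and hmem)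
  filter_upwards [eventually_gt_atTop (1 / r), eventually_ge_atTop C] with K hK hCK t ht
  have hr' : 0 < 1 / r := by positivity
  have hKr : 1 / K < r := by
    rw [one_div_lt (hr'.trans hK) hr]; exact hK
  have h := hball (y := t) (by rw [Real.dist_eq, sub_zero]; exact ht.trans_lt hKr)
  refine ⟨h.2, ?_⟩
  have h0 : q.partialSum 2 t = F.logPartition θ + t * F.mean θ := by
    have e0 : q 0 (fun _ => t) = F.logPartition θ := hq.coeff_zero _
    have e1 : q.coeff 1 = F.mean θ := by
      rw [F.mean_eq_deriv hθ, hq.deriv]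
      rfl
    rw [FormalMultilinearSeries.partialSum, Finset.sum_range_succ, Finset.sum_range_one, e0,
      FormalMultilinearSeries.apply_eq_pow_smul_coeff, e1]
    simp
  have h1 := h.1
  rw [h0, Real.norm_eq_abs, norm_pow, norm_norm, Real.norm_eq_abs, sq_abs] at h1
  have h2 := (abs_le.mp h1).2
  nlinarith [mul_le_mul_of_nonneg_right hCK (sq_nonneg t)]

variable {Ω : Type*} [MeasurableSpace Ω] {P : Measure Ω} {Y : ℕ → Ω → ℝ} {m : ℝ}

lemma mgf_eq {Z : Ω → ℝ} (hm : m ∈ F.means) (hZ : HasLaw Z (F.law m) P) {t : ℝ}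
    (ht : F.param m + t ∈ F.Θ) :
    mgf Z P t = Real.exp (F.logPartition (F.param m + t) - F.logPartition (F.param m)) := by
  have h := F.integral_exp_ν (F.param_mem hm) ht
  rw [add_sub_cancel_left] at h
  rw [← h]
  exact hZ.integral_comp (f := fun x => Real.exp (t * x)) (by fun_prop)

lemma mgf_sum_eq (hm : m ∈ F.means) (hY : ∀ s, HasLaw (Y s) (F.law m) P) (hind : iIndepFun Y P)
    {t : ℝ} (ht : F.param m + t ∈ F.Θ) (s : ℕ) :
    mgf (∑ r ∈ Finset.range s, Y r) P t =
      Real.exp (s * (F.logPartition (F.param m + t) - F.logPartition (F.param m))) := by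
  rw [hind.mgf_sum₀ (fun r => (hY r).aemeasurable),
    Finset.prod_congr rfl fun r _ => mgf_eq hm (hY r) ht, Finset.prod_const, Finset.card_range,
    ← Real.exp_nat_mul]

/-- A non-integrable exponential would have `mgf` equal to the default value `0`, but the formula
for it is positive. -/
lemma integrable_exp_sum [IsProbabilityMeasure P] (hm : m ∈ F.means) (hY : ∀ s, HasLaw (Y s) (F.law m) P)
    (hind : iIndepFun Y P) {t : ℝ} (ht : F.param m + t ∈ F.Θ) (s : ℕ) :
    Integrable (fun ω => Real.exp (t * (∑ r ∈ Finset.range s, Y r) ω)) P :=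
  mgf_pos_iff.mp (by rw [mgf_sum_eq hm hY hind ht]; exact Real.exp_pos _)

lemma measure_empirical_dev_le [IsProbabilityMeasure P] (hm : m ∈ F.means) (hY : ∀ s, HasLaw (Y s) (F.law m) P)
    (hind : iIndepFun Y P) {K : ℝ} (hK : 0 < K) (hcgf : ∀ t : ℝ, |t| ≤ 1 / K →
      F.param m + t ∈ F.Θ ∧ F.logPartition (F.param m + t) - F.logPartition (F.param m) ≤
        t * F.mean (F.param m) + K * t ^ 2)
    {η : ℝ} (hη : 0 < η) (hη2 : η ≤ 2) {s : ℕ} (hs : 0 < s) :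
    P {ω | η < |(∑ r ∈ Finset.range s, Y r ω) / (s : ℝ) - m|} ≤
      ENNReal.ofReal (2 * Real.exp (-(η ^ 2 / (4 * K)) * s)) := by
  have hs' : (0 : ℝ) < s := Nat.cast_pos.mpr hs
  rw [F.mean_param hm] at hcgf
  -- This minimises the Chernoff exponent `K t² - t η`, with value `-η² / (4K)`. The assumption `η ≤
  -- 2` gives `t ≤ 1 / K`.
  set t := η / (2 * K) with ht
  have htpos : 0 < t := by positivity
  have htK : |t| ≤ 1 / K := by
    rw [abs_of_pos htpos, ht, div_le_div_iff₀ (by positivity) hK]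
    nlinarith
  have hexp : K * t ^ 2 - t * η = -(η ^ 2 / (4 * K)) := by
    rw [ht]; field_simp; ring
  set Z := ∑ r ∈ Finset.range s, Y r
  have hup : P.real {ω | s * (m + η) ≤ Z ω} ≤ Real.exp (-(η ^ 2 / (4 * K)) * s) := by
    obtain ⟨h1, h2⟩ := hcgf t htK
    refine (measure_ge_le_exp_mul_mgf _ htpos.le (integrable_exp_sum hm hY hind h1 s)).trans ?_
    rw [mgf_sum_eq hm hY hind h1, ← Real.exp_add, Real.exp_le_exp, ← hexp]
    nlinarith [mul_le_mul_of_nonneg_left h2 hs'.le]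
  have hdown : P.real {ω | Z ω ≤ s * (m - η)} ≤ Real.exp (-(η ^ 2 / (4 * K)) * s) := by
    obtain ⟨h1, h2⟩ := hcgf (-t) (by rwa [abs_neg])
    refine (measure_le_le_exp_mul_mgf _ (by linarith)
      (integrable_exp_sum hm hY hind h1 s)).trans ?_
    rw [mgf_sum_eq hm hY hind h1, ← Real.exp_add, Real.exp_le_exp, ← hexp]
    nlinarith [mul_le_mul_of_nonneg_left h2 hs'.le]
  have hsub : {ω | η < |(∑ r ∈ Finset.range s, Y r ω) / (s : ℝ) - m|} ⊆
      {ω | s * (m + η) ≤ Z ω} ∪ {ω | Z ω ≤ s * (m - η)} := by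
    intro ω hω
    have hω : η < |(∑ r ∈ Finset.range s, Y r ω) / (s : ℝ) - m| := hω
    have hZ : Z ω = ∑ r ∈ Finset.range s, Y r ω := Finset.sum_apply _ _ _
    rcases lt_abs.mp hω with h | h
    · left
      change s * (m + η) ≤ Z ω
      have : m + η ≤ (∑ r ∈ Finset.range s, Y r ω) / (s : ℝ) := by linarith
      rw [le_div_iff₀ hs'] at this
      rw [hZ]; linarith
    · right
      change Z ω ≤ s * (m - η)
      have : (∑ r ∈ Finset.range s, Y r ω) / (s : ℝ) ≤ m - η := by linarith
      rw [div_le_iff₀ hs'] at this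
      rw [hZ]; linarith
  refine (measure_mono hsub).trans ((measure_union_le _ _).trans ?_)
  rw [two_mul, ENNReal.ofReal_add (Real.exp_pos _).le (Real.exp_pos _).le]
  refine add_le_add ?_ ?_
  · rw [← ofReal_measureReal]; exact ENNReal.ofReal_le_ofReal hup
  · rw [← ofReal_measureReal]; exact ENNReal.ofReal_le_ofReal hdown

end ExpFamily

/-- A geometric series, with `1 / (1 - exp (-r)) ≤ 1 + 1 / r` deduced from `1 + r ≤ exp r`. -/
lemma tsum_ofReal_exp_le {r : ℝ} (hr : 0 < r) (S : ℕ) :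
    ∑' s : ℕ, ENNReal.ofReal (2 * Real.exp (-r * (S + s : ℕ))) ≤
      ENNReal.ofReal (2 * Real.exp (-r * S) * (1 + 1 / r)) := by
  have hq : Real.exp (-r) < 1 := Real.exp_zero ▸ Real.exp_lt_exp.mpr (by linarith)
  have hq0 := Real.exp_pos (-r)
  have h1 : ∀ s : ℕ, 2 * Real.exp (-r * (S + s : ℕ)) =
      2 * Real.exp (-r * S) * Real.exp (-r) ^ s := by
    intro s
    rw [← Real.exp_nat_mul, mul_assoc, ← Real.exp_add]
    push_cast
    ring_nf
  have hsum : Summable fun s : ℕ => 2 * Real.exp (-r * S) * Real.exp (-r) ^ s :=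
    (summable_geometric_of_lt_one hq0.le hq).mul_left _
  simp_rw [h1]
  rw [← ENNReal.ofReal_tsum_of_nonneg (fun s => by positivity) hsum, tsum_mul_left,
    tsum_geometric_of_lt_one hq0.le hq]
  refine ENNReal.ofReal_le_ofReal (mul_le_mul_of_nonneg_left ?_ (by positivity))
  have h2 : Real.exp (-r) ≤ 1 / (1 + r) := by
    rw [Real.exp_neg, ← one_div]
    exact one_div_le_one_div_of_le (by linarith) (by linarith [Real.add_one_le_exp r])
  have h3 : r / (1 + r) ≤ 1 - Real.exp (-r) := by
    have : r / (1 + r) = 1 - 1 / (1 + r) := by field_simp; ring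
    linarith
  refine (inv_anti₀ (by positivity) h3).trans (le_of_eq ?_)
  field_simp
  ring

/-- All empirical means concentrate from the `S`-th pull on, up to an event whose probability is
exponentially small in `S`. -/
lemma exists_measure_not_concentrated_le {F : ExpFamily} {n : ℕ} {μ : Fin n → ℝ}
    (hμ : ∀ i, μ i ∈ F.means) {Ω : Type*} [MeasurableSpace Ω] {P : Measure Ω}
    [IsProbabilityMeasure P] {X : Fin n → ℕ → Ω → ℝ}
    (hlaw : ∀ i s, HasLaw (X i s) (F.law (μ i)) P)
    (hindep : iIndepFun (fun is : Fin n × ℕ => X is.1 is.2) P) :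
    ∃ c > 0, ∀ η : ℝ, 0 < η → η ≤ 2 → ∀ S : ℕ, 0 < S →
      P {ω | ¬ Concentrated μ (fun i s => X i s ω) S η} ≤
        ENNReal.ofReal (n * (2 * Real.exp (-(c * η ^ 2) * S) * (1 + 1 / (c * η ^ 2)))) := by
  obtain ⟨K, hK, hK0⟩ := ((eventually_all.mpr fun i =>
    ExpFamily.eventually_logPartition_le (F.param_mem (hμ i))).and
      (eventually_gt_atTop (0 : ℝ))).exists
  refine ⟨1 / (4 * K), by positivity, fun η hη hη2 S hS => ?_⟩
  have hr : 1 / (4 * K) * η ^ 2 = η ^ 2 / (4 * K) := by ring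
  rw [hr]
  have hsub : {ω | ¬ Concentrated μ (fun i s => X i s ω) S η} ⊆ ⋃ i, ⋃ s : ℕ,
      {ω | η < |(∑ r ∈ Finset.range (S + s), X i r ω) / ((S + s : ℕ) : ℝ) - μ i|} := by
    intro ω hω
    have hω : ¬ Concentrated μ (fun i s => X i s ω) S η := hω
    simp only [Concentrated, not_forall, not_le] at hω
    obtain ⟨i, s, hs, h⟩ := hω
    refine Set.mem_iUnion.mpr ⟨i, Set.mem_iUnion.mpr ⟨s - S, ?_⟩⟩
    rw [Nat.add_sub_cancel' hs]
    exact h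
  have hi : ∀ i, P (⋃ s : ℕ,
      {ω | η < |(∑ r ∈ Finset.range (S + s), X i r ω) / ((S + s : ℕ) : ℝ) - μ i|}) ≤
      ENNReal.ofReal (2 * Real.exp (-(η ^ 2 / (4 * K)) * S) * (1 + 1 / (η ^ 2 / (4 * K)))) := by
    intro i
    have hind : iIndepFun (X i) P :=
      hindep.precomp (g := fun s : ℕ => (i, s)) fun a b h => (Prod.mk.inj h).2
    refine (measure_iUnion_le _).trans (le_trans (ENNReal.tsum_le_tsum fun s => ?_)
      (tsum_ofReal_exp_le (by positivity) S))
    exact ExpFamily.measure_empirical_dev_le (hμ i) (hlaw i) hind hK0 (hK i) hη hη2 (by omega)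
  refine (measure_mono hsub).trans ((measure_iUnion_le _).trans ?_)
  rw [tsum_fintype]
  refine (Finset.sum_le_sum fun i _ => hi i).trans (le_of_eq ?_)
  rw [Finset.sum_const, Finset.card_univ, Fintype.card_fin, nsmul_eq_mul,
    ENNReal.ofReal_mul (Nat.cast_nonneg n), ENNReal.ofReal_natCast]

end TriBBAI

/-! ### Asymptotics as `δ` tends to `0`, and the expected cost -/

namespace TriBBAI

lemma eventually_mul_log_pow_le (m : ℕ) (C : ℝ) : ∀ᶠ x : ℝ in atTop, C * Real.log x ^ m ≤ x := by
  have hC : 0 < 1 / (|C| + 1) := by positivity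
  filter_upwards [(Real.isLittleO_pow_log_id_atTop (n := m)).bound hC, eventually_ge_atTop 1]
    with x hx hx1
  have hlog : 0 ≤ Real.log x := Real.log_nonneg hx1
  rw [Real.norm_eq_abs, abs_of_nonneg (by positivity), id, Real.norm_eq_abs,
    abs_of_nonneg (show 0 ≤ x by linarith), one_div, inv_mul_eq_div, le_div_iff₀ (by positivity)] at hx
  nlinarith [le_abs_self C, pow_nonneg hlog m]

lemma eventually_mul_log_pow_le_sqrt (m : ℕ) (C : ℝ) :
    ∀ᶠ x : ℝ in atTop, C * Real.log x ^ m ≤ Real.sqrt x := by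
  filter_upwards [eventually_mul_log_pow_le (m * 2) (C ^ 2)] with x hx
  refine Real.le_sqrt_of_sq_le ?_
  rwa [mul_pow, ← pow_mul]

lemma max_ceil_le {s a : ℝ} (hs : 0 ≤ s) (ha : 0 ≤ a) :
    ((max ⌈s⌉₊ ⌈a⌉₊ : ℕ) : ℝ) ≤ s + a + 1 := by
  rw [Nat.cast_max]
  exact max_le (by linarith [Nat.ceil_lt_add_one hs]) (by linarith [Nat.ceil_lt_add_one ha])

lemma tendsto_log_one_div : Tendsto (fun δ : ℝ => Real.log (1 / δ)) (𝓝[>] 0) atTop := by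
  simp_rw [one_div]
  exact Real.tendsto_log_atTop.comp tendsto_inv_nhdsGT_zero

/-- The threshold of the stopping rule exceeds `log (1 / δ)` by a lower order term only. -/
lemma threshold_le {δ α τ L : ℝ} (hδ : 0 < δ) (hL : L = Real.log (1 / δ)) (hL1 : 1 ≤ L)
    (hlog : 1 ≤ Real.log L) (hα : α ≤ 2) (hτ1 : 1 ≤ τ) (hτ : τ ≤ L ^ 2) (n : ℕ) :
    (params n α δ).β τ (δ / 2) ≤ L + 7 * Real.log L := by
  have h2 : Real.log 2 < 1 := Real.log_two_lt_d9.trans (by norm_num)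
  have h2' : 0 < Real.log 2 := Real.log_pos (by norm_num)
  have e1 : Real.log (1 / (δ / 2)) = L + Real.log 2 := by
    rw [hL, one_div_div, Real.log_div (by norm_num) hδ.ne', Real.log_div one_ne_zero hδ.ne',
      Real.log_one]
    ring
  have e2 : Real.log (δ / 2) = -(L + Real.log 2) := by
    rw [← e1, one_div, Real.log_inv, neg_neg]
  change Real.log (Real.log (1 / (δ / 2)) * τ ^ α / (δ / 2)) ≤ _
  have hτ0 : 0 < τ := by linarith
  have hτα : 0 < τ ^ α := Real.rpow_pos_of_pos hτ0 α
  have hs : 0 < L + Real.log 2 := by linarith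
  rw [e1, Real.log_div (by positivity) (by positivity), Real.log_mul hs.ne' hτα.ne',
    Real.log_rpow hτ0, e2]
  have h3 : Real.log (L + Real.log 2) ≤ Real.log 2 + Real.log L := by
    rw [← Real.log_mul (by norm_num) (by linarith)]
    exact Real.log_le_log hs (by linarith)
  have h4 : Real.log τ ≤ 2 * Real.log L := by
    have := Real.log_le_log hτ0 hτ
    rwa [Real.log_pow, Nat.cast_ofNat] at this
  have h5 : 0 ≤ Real.log τ := Real.log_nonneg hτ1
  -- The `7` is `1` from `log (L + log 2)`, `4` from `α * log τ`, and `2` covering two terms `log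
  -- 2`, since `log L ≥ 1`.
  nlinarith [mul_le_mul hα h4 h5 (by norm_num)]

lemma exists_eventually_mem {F : ExpFamily} {n : ℕ} {R : Rules F n} {μ B : Fin n → ℝ} {k : Fin n}
    (hμ : F.IsInstance k μ) (h : ∀ᶠ b in 𝓝 μ, IsReliable R k b B) :
    ∀ᶠ η in 𝓝[>] (0 : ℝ), η ≤ 2 ∧ (∀ i, i ≠ k → 2 * η < μ k - μ i) ∧
      ∀ y : Fin n → ℝ, (∀ i, |y i - μ i| ≤ 5 * η) → IsReliable R k y B := by
  obtain ⟨r, hr, hball⟩ := Metric.eventually_nhds_iff.mp h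
  have h1 : ∀ᶠ η in 𝓝[>] (0 : ℝ), ∀ i, i ≠ k → 2 * η < μ k - μ i := by
    refine eventually_all.mpr fun i => ?_
    by_cases hi : i = k
    · exact Eventually.of_forall fun _ h => absurd hi h
    have : 0 < (μ k - μ i) / 2 := by linarith [hμ.2 i hi]
    filter_upwards [nhdsWithin_le_nhds (Iio_mem_nhds this)] with η hη _
    have : η < (μ k - μ i) / 2 := hη
    linarith
  have hr5 : 0 < r / 5 := by positivity
  filter_upwards [h1, nhdsWithin_le_nhds (Iio_mem_nhds hr5),
    nhdsWithin_le_nhds (Iio_mem_nhds (zero_lt_two (α := ℝ)))] with η h1 h2 h3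
  refine ⟨le_of_lt h3, h1, fun y hy => hball ((dist_pi_lt_iff hr).mpr fun i => ?_)⟩
  have h2 : η < r / 5 := h2
  rw [Real.dist_eq]
  linarith [hy i]

section Bounds

variable {F : ExpFamily} {n : ℕ} {R : Rules F n} {μ : Fin n → ℝ} {k : Fin n}
  {x : Fin n → ℕ → ℝ} {α δ L : ℝ}

lemma sum_explore_le (hL : L = Real.log (1 / δ)) (hL1 : 1 ≤ L) (hlog : 0 ≤ Real.log L)
    (hlogL : 2 * Real.log L ≤ L) (hLn : 4 * n ≤ L) :
    ((∑ i, explore R (params n α δ) x i : ℕ) : ℝ) ≤ L ^ 2 := by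
  by_cases hn : n = 0
  · subst hn
    simp only [Finset.univ_eq_empty, Finset.sum_empty, Nat.cast_zero]
    positivity
  have hn' : (0 : ℝ) < n := Nat.cast_pos.mpr (Nat.pos_of_ne_zero hn)
  have hL2 : (params n α δ).L₂ = L * Real.log L / n := by rw [hL]; rfl
  have hL1' : (params n α δ).L₁ = Real.sqrt L := by rw [hL]; rfl
  have h0 : 0 ≤ L * Real.log L / n := by positivity
  have h1 : ∀ i, (explore R (params n α δ) x i : ℝ) ≤ Real.sqrt L + L * Real.log L / n + 1 := by
    intro i
    have := explore_le R (params n α δ) (x := x) (by rw [hL2]; exact h0) i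
    rw [hL1', hL2] at this
    exact (Nat.cast_le.mpr this).trans (max_ceil_le (Real.sqrt_nonneg L) h0)
  have hsqrt : Real.sqrt L ≤ L := by
    rw [Real.sqrt_le_left (by linarith)]
    nlinarith
  push_cast
  refine (Finset.sum_le_sum fun i _ => h1 i).trans ?_
  rw [Finset.sum_const, Finset.card_univ, Fintype.card_fin, nsmul_eq_mul]
  have h2 : (n : ℝ) * (Real.sqrt L + L * Real.log L / n + 1) =
      n * Real.sqrt L + L * Real.log L + n := by
    field_simp
  rw [h2]
  nlinarith

/-- This holds for every reward sequence: `L₂` caps Stage II, and Stage IV adds at most `⌈L ^ 2⌉₊`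
pulls per arm. It prices the exceptional event. -/
lemma numPulls_le_sq (hL : L = Real.log (1 / δ)) (hL1 : 1 ≤ L) (hlog : 0 ≤ Real.log L)
    (hlogL : 2 * Real.log L ≤ L) (hLn : 4 * n ≤ L) :
    (numPulls R (params n α δ) x : ℝ) ≤ (2 * n + 1) * L ^ 2 := by
  have hL3 : (params n α δ).L₃ = L ^ 2 := by rw [hL]; rfl
  have h1 : ∀ i, finalPulls R (params n α δ) x i ≤
      explore R (params n α δ) x i + ⌈L ^ 2⌉₊ := by
    intro i
    rw [finalPulls]
    split_ifs
    · exact Nat.le_add_right _ _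
    · rw [hL3]
      exact max_le (Nat.le_add_right _ _) (Nat.le_add_left _ _)
  have h2 : (numPulls R (params n α δ) x : ℝ) ≤
      ((∑ i, (explore R (params n α δ) x i + ⌈L ^ 2⌉₊) : ℕ) : ℝ) :=
    Nat.cast_le.mpr (Finset.sum_le_sum fun i _ => h1 i)
  rw [Finset.sum_add_distrib, Finset.sum_const, Finset.card_univ, Fintype.card_fin,
    smul_eq_mul] at h2
  push_cast at h2
  have h3 := sum_explore_le (R := R) (x := x) (α := α) hL hL1 hlog hlogL hLn
  push_cast at h3
  have h4 := Nat.ceil_lt_add_one (show 0 ≤ L ^ 2 by positivity)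
  have h5 : (1 : ℝ) ≤ L ^ 2 := one_le_pow₀ hL1
  have hn : (0 : ℝ) ≤ n := Nat.cast_nonneg n
  nlinarith [mul_le_mul_of_nonneg_left h4.le hn, mul_le_mul_of_nonneg_left h5 hn]

/-- The cost of a run on concentrated rewards. -/
lemma numPulls_le_of_concentrated {w : Fin n → ℝ} (hw : w ∈ stdSimplex ℝ (Fin n)) {T κ Δ η : ℝ}
    (hδ : 0 < δ) (hL : L = Real.log (1 / δ)) (hlog : 1 ≤ Real.log L)
    (hL1 : 1 ≤ L) (hlogL : 2 * Real.log L ≤ L) (hLn : 4 * n ≤ L)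
    (hα : 1 ≤ α) (hα2 : α ≤ 2) (hT : 0 ≤ T) (hκ : 0 < κ) (hη : η = 1 / (4 * Real.log L))
    (hgap : ∀ i, i ≠ k → 2 * η < μ k - μ i)
    (hmem : ∀ y : Fin n → ℝ, (∀ i, |y i - μ i| ≤ 5 * η) → IsReliable R k y fun i => w i * T + κ)
    (hΔ : 0 < Δ) (hμΔ : ∀ i, μ k - μ i ≤ Δ) (hL2 : 2 * n * (T + κ) ≤ Real.log L)
    (hβ : 14 * Δ * Real.log L ^ 2 ≤ L)
    (hx : Concentrated μ x ⌈Real.sqrt L⌉₊ η) :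
    (numPulls R (params n α δ) x : ℝ) ≤ n * Real.sqrt L + n + α * L * (T + n * κ) := by
  have hn : (0 : ℝ) < n := Nat.cast_pos.mpr (Fin.pos k)
  have hw1 : ∀ i, w i ≤ 1 := fun i => by
    rw [← hw.2]
    exact Finset.single_le_sum (fun i _ => hw.1 i) (Finset.mem_univ i)
  have hαL : 0 ≤ α * L := by positivity
  have hηpos : 0 < η := by rw [hη]; positivity
  have hB : ∀ i, 0 ≤ w i * T + κ := fun i => by
    have := hw.1 i
    positivity
  have G : GoodRun R (params n α δ) μ (fun i => w i * T + κ) k x ⌈Real.sqrt L⌉₊ η :=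
    { concentrated := hx
      gap := hgap
      shift := by
        change 1 / Real.log (Real.log (1 / δ)) = _
        rw [hη, ← hL]
        field_simp
      nonneg := hηpos.le
      mem := hmem
      α_nonneg := by change 0 ≤ α; linarith
      log_nonneg := by change 0 ≤ Real.log (1 / δ); rw [← hL]; linarith
      L₂_ge := by
        intro i
        change α * Real.log (1 / δ) * (w i * T + κ) ≤
          Real.log (1 / δ) * Real.log (Real.log (1 / δ)) / n
        rw [← hL, le_div_iff₀ hn]
        have h1 : w i * T + κ ≤ T + κ := by nlinarith [hw1 i]
        have h2 : α * (w i * T + κ) ≤ 2 * (T + κ) :=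
          mul_le_mul hα2 h1 (hB i) (by norm_num)
        calc α * L * (w i * T + κ) * n = L * (n * (α * (w i * T + κ))) := by ring
          _ ≤ L * (n * (2 * (T + κ))) := by gcongr
          _ ≤ L * Real.log L := by
            refine mul_le_mul_of_nonneg_left ?_ (by linarith)
            linarith
      L₂_nonneg := by
        change 0 ≤ Real.log (1 / δ) * Real.log (Real.log (1 / δ)) / n
        rw [← hL]
        positivity
      start := by
        change _ ≤ ⌈Real.sqrt (Real.log (1 / δ))⌉₊
        rw [← hL] }
  have hS : 0 < ⌈Real.sqrt L⌉₊ := Nat.ceil_pos.mpr (Real.sqrt_pos.mpr (by linarith))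
  have hτ1 : (1 : ℝ) ≤ ((∑ i, explore R (params n α δ) x i : ℕ) : ℝ) := by
    rw [Nat.one_le_cast]
    exact (hS.trans_le (G.le_explore k)).trans_le
      (Finset.single_le_sum (f := fun i => explore R (params n α δ) x i)
        (fun i _ => Nat.zero_le _) (Finset.mem_univ k))
  have hst := G.stops hS (by change 1 ≤ Real.log (1 / δ); rw [← hL]; exact hL1) hΔ hμΔ (by
    refine (threshold_le hδ hL hL1 hlog hα2 hτ1
      (sum_explore_le hL hL1 (by linarith) hlogL hLn) n).trans ?_
    change _ ≤ (1 + 2 * η / Δ) * (α * Real.log (1 / δ))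
    rw [← hL]
    -- The surplus created by the shift equals `L / (2 * Δ * log L)`, so this is exactly `hβ`.
    -- Afterwards `α ≥ 1` suffices.
    have h1 : 7 * Real.log L ≤ 2 * η / Δ * L := by
      rw [hη, div_mul_eq_mul_div, le_div_iff₀ hΔ]
      have : 2 * (1 / (4 * Real.log L)) * L = L / (2 * Real.log L) := by field_simp; norm_num
      rw [this, le_div_iff₀ (by positivity)]
      nlinarith
    have h2 : 0 ≤ 2 * η / Δ := by positivity
    calc L + 7 * Real.log L ≤ (1 + 2 * η / Δ) * L := by linarith
      _ ≤ (1 + 2 * η / Δ) * (α * L) := by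
        refine mul_le_mul_of_nonneg_left ?_ (by linarith)
        nlinarith)
  have h1 := G.numPulls_le hst
  change numPulls R (params n α δ) x ≤ ∑ i, max ⌈Real.sqrt (Real.log (1 / δ))⌉₊
    ⌈α * Real.log (1 / δ) * (w i * T + κ)⌉₊ at h1
  rw [← hL] at h1
  refine (Nat.cast_le.mpr h1).trans ?_
  push_cast
  calc ∑ i, max (⌈Real.sqrt L⌉₊ : ℝ) (⌈α * L * (w i * T + κ)⌉₊ : ℝ)
      ≤ ∑ i, (Real.sqrt L + α * L * (w i * T + κ) + 1) := by
        refine Finset.sum_le_sum fun i _ => ?_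
        rw [← Nat.cast_max]
        exact max_ceil_le (Real.sqrt_nonneg L) (mul_nonneg hαL (hB i))
    _ = n * Real.sqrt L + n + α * L * (T + n * κ) := by
        simp only [Finset.sum_add_distrib, ← Finset.mul_sum, ← Finset.sum_mul, hw.2,
          Finset.sum_const, Finset.card_univ, Fintype.card_fin, nsmul_eq_mul]
        ring

end Bounds

/-- The contribution of the exceptional event is negligible. -/
lemma eventually_exceptional_le {c : ℝ} (hc : 0 < c) : ∀ᶠ L : ℝ in atTop, ∀ η : ℝ,
    η = 1 / (4 * Real.log L) →
    2 * Real.exp (-(c * η ^ 2) * ⌈Real.sqrt L⌉₊) * (1 + 1 / (c * η ^ 2)) ≤ 2 / L ^ 2 := by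
  filter_upwards [eventually_mul_log_pow_le_sqrt 3 (48 / c), eventually_mul_log_pow_le 2 (32 / c),
    eventually_ge_atTop 2, Real.tendsto_log_atTop.eventually_ge_atTop 1] with L h1 h2 h3 h4 η hη
  have hr : c * η ^ 2 = c / (16 * Real.log L ^ 2) := by
    rw [hη]; field_simp; norm_num
  have hL : 0 < L := by linarith
  have hl : 0 < Real.log L := by linarith
  -- Since `η² = 1 / (16 log² L)`, the constant `48 = 3 * 16` produces the power `L⁻³`. One factor
  -- `L` is then spent on `1 + 1 / (c * η ^ 2)`.
  have e1 : Real.exp (-(c * η ^ 2) * ⌈Real.sqrt L⌉₊) ≤ (L ^ 3)⁻¹ := by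
    rw [← Real.exp_log (show 0 < (L ^ 3)⁻¹ by positivity), Real.exp_le_exp, Real.log_inv,
      Real.log_pow, neg_mul, neg_le_neg_iff]
    have h5 : (48 / c) * Real.log L ^ 3 ≤ ⌈Real.sqrt L⌉₊ := h1.trans (Nat.le_ceil _)
    calc ((3 : ℕ) : ℝ) * Real.log L = c * η ^ 2 * ((48 / c) * Real.log L ^ 3) := by
          rw [hr]; field_simp; norm_num
      _ ≤ _ := mul_le_mul_of_nonneg_left h5 (by rw [hr]; positivity)
  have e2 : 1 + 1 / (c * η ^ 2) ≤ L := by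
    have : 1 / (c * η ^ 2) = (32 / c) * Real.log L ^ 2 / 2 := by
      rw [hr]; field_simp; norm_num
    rw [this]
    linarith
  have e3 : 0 ≤ 1 + 1 / (c * η ^ 2) := by rw [hr]; positivity
  calc _ ≤ 2 * (L ^ 3)⁻¹ * L := by gcongr
    _ = 2 / L ^ 2 := by field_simp

/-- Neither `f` nor `s` is assumed measurable, as the choices in `Rules` need not be. The bound
therefore goes through the measurable hull of `s`. -/
lemma lintegral_le_add_mul {Ω : Type*} [MeasurableSpace Ω] {P : Measure Ω}
    [IsProbabilityMeasure P] {f : Ω → ℝ≥0∞} {A C : ℝ≥0∞} {s : Set Ω} (h1 : ∀ ω, ω ∉ s → f ω ≤ A)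
    (h2 : ∀ ω, f ω ≤ C) : ∫⁻ ω, f ω ∂P ≤ A + C * P s := by
  have hle : ∀ ω, f ω ≤ A + (toMeasurable P s).indicator (fun _ => C) ω := by
    intro ω
    by_cases hω : ω ∈ toMeasurable P s
    · rw [Set.indicator_of_mem hω]
      exact (h2 ω).trans le_add_self
    · exact (h1 ω fun h => hω (subset_toMeasurable P s h)).trans le_self_add
  refine (lintegral_mono hle).trans (le_of_eq ?_)
  rw [lintegral_add_left measurable_const, lintegral_const, measure_univ, mul_one,
    lintegral_indicator_const (measurableSet_toMeasurable P s), measure_toMeasurable]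

section Main

variable {F : ExpFamily} {n : ℕ} {R : Rules F n} {μ : Fin n → ℝ} {k : Fin n}
  {Ω : Type*} [MeasurableSpace Ω] {P : Measure Ω} [IsProbabilityMeasure P]
  {X : Fin n → ℕ → Ω → ℝ} {α : ℝ → ℝ}

lemma eventually_normalizedCost_le (hμ : F.IsInstance k μ)
    (hlaw : ∀ i s, HasLaw (X i s) (F.law (μ i)) P)
    (hindep : iIndepFun (fun is : Fin n × ℕ => X is.1 is.2) P)
    (hα : ∀ᶠ δ in 𝓝[>] (0 : ℝ), 1 ≤ α δ ∧ α δ ≤ 2) {κ : ℝ} (hκ : 0 < κ) :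
    ∀ᶠ δ in 𝓝[>] (0 : ℝ), normalizedCost R P X (α δ) δ ≤
      ENNReal.ofReal (α δ * ((F.charTime k μ).toReal + n * κ) +
        (n / Real.sqrt (Real.log (1 / δ)) + (n + (2 * n + 1) * n * 2) / Real.log (1 / δ))) := by
  obtain ⟨w, hw⟩ := ExpFamily.exists_isOptimalWeight hμ
  set T := (F.charTime k μ).toReal
  have hT : 0 ≤ T := ENNReal.toReal_nonneg
  obtain ⟨c, hc, hconc⟩ := exists_measure_not_concentrated_le hμ.1 hlaw hindep
  -- The summand `1` keeps `Δ` positive even with a single arm.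
  set Δ := 1 + ∑ i, |μ k - μ i|
  have hΔ : 0 < Δ := by positivity
  have hμΔ : ∀ i, μ k - μ i ≤ Δ := fun i => by
    have := Finset.single_le_sum (f := fun i => |μ k - μ i|) (fun i _ => abs_nonneg _)
      (Finset.mem_univ i)
    have := le_abs_self (μ k - μ i)
    simp only [Δ]
    linarith
  have hηlim : Tendsto (fun L : ℝ => 1 / (4 * Real.log L)) atTop (𝓝[>] 0) := by
    simp_rw [one_div]
    exact tendsto_inv_atTop_nhdsGT_zero.comp
      (Real.tendsto_log_atTop.const_mul_atTop (by norm_num : (0 : ℝ) < 4))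
  have hη := hηlim.eventually (exists_eventually_mem hμ (eventually_isReliable (R := R) hμ hw hκ))
  filter_upwards [hα, self_mem_nhdsWithin, tendsto_log_one_div.eventually hη,
    tendsto_log_one_div.eventually (Real.tendsto_log_atTop.eventually_ge_atTop 1),
    tendsto_log_one_div.eventually
      (Real.tendsto_log_atTop.eventually_ge_atTop (2 * n * (T + κ))),
    tendsto_log_one_div.eventually (eventually_ge_atTop 1),
    tendsto_log_one_div.eventually (eventually_ge_atTop (4 * (n : ℝ))),
    tendsto_log_one_div.eventually (eventually_mul_log_pow_le 1 2),
    tendsto_log_one_div.eventually (eventually_mul_log_pow_le 2 (14 * Δ)),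
    tendsto_log_one_div.eventually (eventually_exceptional_le hc)]
    with δ hαδ hδ hηδ hlog hL2 hL1 hLn hlogL hβ hexc
  set L := Real.log (1 / δ) with hL
  have hδ : 0 < δ := hδ
  have hL0 : 0 < L := by linarith
  rw [pow_one] at hlogL
  obtain ⟨η, hηdef⟩ : ∃ η, η = 1 / (4 * Real.log L) := ⟨_, rfl⟩
  rw [← hηdef] at hηδ
  obtain ⟨hη2, hgap, hmem⟩ := hηδ
  have hηpos : 0 < η := by rw [hηdef]; positivity
  have hS : 0 < ⌈Real.sqrt L⌉₊ := Nat.ceil_pos.mpr (Real.sqrt_pos.mpr hL0)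
  have hbad : P {ω | ¬ Concentrated μ (fun i s => X i s ω) ⌈Real.sqrt L⌉₊ η} ≤
      ENNReal.ofReal (n * (2 / L ^ 2)) :=
    (hconc η hηpos hη2 _ hS).trans (ENNReal.ofReal_le_ofReal
      (mul_le_mul_of_nonneg_left (hexc η hηdef) (Nat.cast_nonneg n)))
  have hint : ∫⁻ ω, (numPulls R (params n (α δ) δ) (fun i s => X i s ω) : ℝ≥0∞) ∂P ≤
      ENNReal.ofReal (n * Real.sqrt L + n + α δ * L * (T + n * κ)) +
        ENNReal.ofReal ((2 * n + 1) * L ^ 2) *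
          P {ω | ¬ Concentrated μ (fun i s => X i s ω) ⌈Real.sqrt L⌉₊ η} := by
    refine lintegral_le_add_mul (fun ω hω => ?_) fun ω => ?_
    · rw [← ENNReal.ofReal_natCast]
      exact ENNReal.ofReal_le_ofReal (numPulls_le_of_concentrated hw.1 hδ hL hlog hL1 hlogL hLn
        hαδ.1 hαδ.2 hT hκ hηdef hgap hmem hΔ hμΔ hL2 hβ (not_not.mp hω))
    · rw [← ENNReal.ofReal_natCast]
      exact ENNReal.ofReal_le_ofReal (numPulls_le_sq hL hL1 (by linarith) hlogL hLn)
  have hα1 : 0 ≤ α δ := by linarith [hαδ.1]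
  have hsum := hint.trans (add_le_add le_rfl (mul_le_mul_right hbad _))
  rw [← ENNReal.ofReal_mul (by positivity),
    ← ENNReal.ofReal_add (by positivity) (by positivity)] at hsum
  rw [normalizedCost]
  refine (ENNReal.div_le_div_right hsum _).trans ?_
  rw [← hL, ← ENNReal.ofReal_div_of_pos hL0]
  refine ENNReal.ofReal_le_ofReal (le_of_eq ?_)
  have hs : 0 < Real.sqrt L := Real.sqrt_pos.mpr hL0
  have hss : Real.sqrt L / L = 1 / Real.sqrt L := by
    rw [div_eq_div_iff hL0.ne' hs.ne', Real.mul_self_sqrt hL0.le, one_mul]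
  have : (n * Real.sqrt L + n + α δ * L * (T + n * κ) +
      (2 * n + 1) * L ^ 2 * (n * (2 / L ^ 2))) / L =
      n * (Real.sqrt L / L) + (n + (2 * n + 1) * n * 2) / L + α δ * (T + n * κ) := by
    field_simp
    ring
  rw [this, hss]
  ring

/-- Both claims at once, as `α` may vary with `δ` towards a limit `a`. For fixed `κ` the error terms
vanish as `δ → 0`, and `κ → 0` comes last. -/
lemma limsup_normalizedCost_le (hμ : F.IsInstance k μ)
    (hlaw : ∀ i s, HasLaw (X i s) (F.law (μ i)) P)
    (hindep : iIndepFun (fun is : Fin n × ℕ => X is.1 is.2) P)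
    (hα : ∀ᶠ δ in 𝓝[>] (0 : ℝ), α δ ∈ Set.Ioc 1 (Real.exp 1 / 2)) {a : ℝ} (ha : 0 ≤ a)
    (hlim : Tendsto α (𝓝[>] 0) (𝓝 a)) :
    limsup (fun δ => normalizedCost R P X (α δ) δ) (𝓝[>] (0 : ℝ)) ≤
      ENNReal.ofReal a * F.charTime k μ := by
  set T := (F.charTime k μ).toReal
  have hα' : ∀ᶠ δ in 𝓝[>] (0 : ℝ), 1 ≤ α δ ∧ α δ ≤ 2 := hα.mono fun δ h =>
    ⟨h.1.le, h.2.trans (by linarith [Real.exp_one_lt_d9])⟩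
  have hbound : ∀ κ > 0, limsup (fun δ => normalizedCost R P X (α δ) δ) (𝓝[>] (0 : ℝ)) ≤
      ENNReal.ofReal (a * (T + n * κ)) := by
    intro κ hκ
    have h1 : Tendsto (fun δ : ℝ => (n : ℝ) / Real.sqrt (Real.log (1 / δ))) (𝓝[>] 0) (𝓝 0) :=
      tendsto_const_nhds.div_atTop (Real.tendsto_sqrt_atTop.comp tendsto_log_one_div)
    have h2 : Tendsto (fun δ : ℝ => ((n : ℝ) + (2 * n + 1) * n * 2) / Real.log (1 / δ))
        (𝓝[>] 0) (𝓝 0) := tendsto_const_nhds.div_atTop tendsto_log_one_div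
    have h3 := (ENNReal.continuous_ofReal.tendsto _).comp
      ((hlim.mul_const (T + n * κ)).add (h1.add h2))
    refine (limsup_le_limsup (eventually_normalizedCost_le hμ hlaw hindep hα' hκ)).trans
      (le_of_eq ?_)
    rw [add_zero, add_zero] at h3
    exact h3.limsup_eq
  have hκlim : Tendsto (fun κ : ℝ => ENNReal.ofReal (a * (T + n * κ))) (𝓝[>] 0)
      (𝓝 (ENNReal.ofReal (a * T))) := by
    have hc : Continuous fun κ : ℝ => ENNReal.ofReal (a * (T + n * κ)) :=
      ENNReal.continuous_ofReal.comp (by fun_prop)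
    have := (hc.tendsto 0).mono_left (nhdsWithin_le_nhds (s := Set.Ioi 0))
    simpa using this
  have h := ge_of_tendsto hκlim (eventually_nhdsWithin_of_forall fun κ hκ => hbound κ hκ)
  rwa [ENNReal.ofReal_mul ha, ENNReal.ofReal_toReal (ExpFamily.charTime_ne_top hμ)] at h

end Main

end TriBBAI

theorem theorem1 (F : TriBBAI.ExpFamily) {n : ℕ} (R : TriBBAI.Rules F n)
    (μ : Fin n → ℝ) (k : Fin n) (hμ : F.IsInstance k μ)
    {Ω : Type*} [MeasurableSpace Ω] (P : Measure Ω) [IsProbabilityMeasure P]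
    (X : Fin n → ℕ → Ω → ℝ)
    (hlaw : ∀ i s, HasLaw (X i s) (F.law (μ i)) P)
    (hindep : iIndepFun (fun is : Fin n × ℕ => X is.1 is.2) P) :
    (∀ α ∈ Set.Ioc 1 (Real.exp 1 / 2),
      limsup (fun δ => TriBBAI.normalizedCost R P X α δ) (𝓝[>] (0 : ℝ)) ≤
        ENNReal.ofReal α * F.charTime k μ) ∧
    (∀ α : ℝ → ℝ, (∀ᶠ δ in 𝓝[>] (0 : ℝ), α δ ∈ Set.Ioc 1 (Real.exp 1 / 2)) →
      Tendsto α (𝓝[>] 0) (𝓝 1) →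
      limsup (fun δ => TriBBAI.normalizedCost R P X (α δ) δ) (𝓝[>] (0 : ℝ)) ≤
        F.charTime k μ) := by
  refine ⟨fun α hα => ?_, fun α hα hlim => ?_⟩
  · exact TriBBAI.limsup_normalizedCost_le (α := fun _ => α) hμ hlaw hindep
      (Eventually.of_forall fun _ => hα) (by linarith [hα.1]) tendsto_const_nhds
  · simpa using TriBBAI.limsup_normalizedCost_le hμ hlaw hindep hα zero_le_one hlim
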